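/- For an open set $\Omega\subset\mathbb R^2$ and a locally integrable $v$ on $\Omega$ put $|v|_{TV}=\sup\int_\Omega v\,\mathrm{div}\,\mathbf w$, the supremum over all $\mathbf w\in C_c^\infty(\Omega;\mathbb R^2)$ with $\sup_x|\mathbf w(x)|\le1$ (Euclidean norm), and write $v\in BV(\Omega)$ if $v\in L^1_{loc}(\Omega)$ and $|v|_{TV}<\infty$. Vectors in $\|\mathbf u\|_{L^\infty}$ are measured in the Euclidean norm, and $\mathrm{div}$ is the distributional divergence. On $\mathbb R^2$ let $\|g\|_{L^{2,1}}=2\int_0^\infty|\{|g|>t\}|^{1/2}\,dt$, let $\|\mathbf v\|_{L^{2,\infty}}$ be the smallest $C$ with $|\{|\mathbf v|>t\}|\le C^2t^{-2}$ for all $t>0$, and let $\psi(x)=\frac1{2\pi}\frac{x}{|x|^2}$. 1. Let $\Omega\subset\mathbb R^2$ be open, $f\in L^2(\Omega)$ and $\lambda>0$. The functional $\mathbf u\mapsto\|\mathbf u\|_{L^\infty(\Omega)}+\lambda\|f-\mathrm{div}\,\mathbf u\|_{L^2(\Omega)}^2$ on $L^\infty(\Omega;\mathbb R^2)$ (with value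 $+\infty$ if $f-\mathrm{div}\,\mathbf u\notin L^2(\Omega)$) has a minimizer. For every minimizer $\mathbf u_\lambda$ the residual $r_\lambda=f-\mathrm{div}\,\mathbf u_\lambda$ is a function in $L^2(\Omega)$, belongs to $BV(\Omega)$, and satisfies $|r_\lambda|_{TV}\le\frac1{2\lambda}$; in particular $r_\lambda\in L^1(\Omega)$ if $\Omega$ has finite measure. 2. $\psi\in L^{2,\infty}(\mathbb R^2)$, and there is a finite constant $\beta$ such that $\|g\|_{L^{2,1}}\le\beta|g|_{TV}$ for all $g\in BV(\mathbb R^2)$ that belong to $L^1(\mathbb R^2)$ or to $L^2(\mathbb R^2)$. 3. Let $\beta$ be any constant as in 2 and $C=\frac\beta2\|\psi\|_{L^{2,\infty}}$. Let $f\in L^2(\mathbb R^2)$, $f\ne0$, let $\mathbf u_1$ be any minimizer of the functional on $\Omega=\mathbb R^2$ with $\lambda=\|f\|_{L^2}^{-1}$, and let $r_1=f-\mathrm{div}\,\mathbf u_1$. Then $\|\mathbf u_1\|_{L^\infty}\le\|f\|_{L^2}$ and $\|r_1\|_{L^{2,1}}\le\frac\beta2\|f\|_{L^2}$. The integral $\mathbf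 u_2(x)=\int_{\mathbb R^2}\psi(x-y)r_1(y)\,dy$ converges absolutely for every $x$, $\mathrm{div}\,\mathbf u_2=r_1$, and $\|\mathbf u_2\|_{L^\infty}\le\|\psi\|_{L^{2,\infty}}\|r_1\|_{L^{2,1}}$, so that $\|\mathbf u_2\|_{L^\infty}\le C\|f\|_{L^2}$. Consequently $\mathbf u=\mathbf u_1+\mathbf u_2$ is a bounded solution of $\mathrm{div}\,\mathbf u=f$ with $\|\mathbf u\|_{L^\infty}\le(1+C)\|f\|_{L^2}$. 4. With the same $C$, for every open $\Omega\subset\mathbb R^2$ and every $f\in L^2(\Omega)$ there is $\mathbf u\in L^\infty(\Omega;\mathbb R^2)$ with $\mathrm{div}\,\mathbf u=f$ in $\Omega$ and $\|\mathbf u\|_{L^\infty(\Omega)}\le(1+C)\|f\|_{L^2(\Omega)}$. -/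

import Mathlib

open scoped ENNReal NNReal

namespace TwoStep

open MeasureTheory

/-- The Euclidean plane `ℝ²`. -/
abbrev Plane : Type := EuclideanSpace ℝ (Fin 2)

/-- The classical divergence of a vector field. -/
noncomputable def divergence (w : Plane → Plane) (x : Plane) : ℝ :=
  ∑ i : Fin 2, (fderiv ℝ w x (EuclideanSpace.single i 1)) i

/-- `φ` is a test function on `Ω`: smooth with compact support contained in `Ω`. -/
def IsTest {F : Type} [NormedAddCommGroup F] [NormedSpace ℝ F] (Ω : Set Plane)
    (φ : Plane → F) : Prop :=
  ContDiff ℝ (⊤ : ℕ∞) φ ∧ HasCompactSupport φ ∧ tsupport φ ⊆ Ω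

/-- `div u = g` on `Ω` in the sense of distributions
(`fderiv ℝ φ x (u x)` is the scalar product of `∇φ(x)` and `u(x)`). -/
def IsWeakDiv (Ω : Set Plane) (u : Plane → Plane) (g : Plane → ℝ) : Prop :=
  LocallyIntegrableOn u Ω ∧ LocallyIntegrableOn g Ω ∧
    ∀ φ : Plane → ℝ, IsTest Ω φ →
      ∫ x in Ω, g x * φ x = - ∫ x in Ω, fderiv ℝ φ x (u x)

/-- The total variation `|v|_TV` on `Ω`, as an extended nonnegative number. -/
noncomputable def totalVariation (Ω : Set Plane) (v : Plane → ℝ) : ℝ≥0∞ :=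
  ⨆ (w : Plane → Plane) (_ : IsTest Ω w ∧ ∀ x, ‖w x‖ ≤ 1),
    ENNReal.ofReal (∫ x in Ω, v x * divergence w x)

/-- `v` is locally integrable on `Ω` and has finite total variation there. -/
def MemBV (Ω : Set Plane) (v : Plane → ℝ) : Prop :=
  LocallyIntegrableOn v Ω ∧ totalVariation Ω v < ∞

/-- `r` is the residual `f - div u`, and it belongs to `L²(Ω)`. -/
def IsResidual (Ω : Set Plane) (f : Plane → ℝ) (u : Plane → Plane) (r : Plane → ℝ) : Prop :=
  MemLp r 2 (volume.restrict Ω) ∧ IsWeakDiv Ω u (fun x => f x - r x)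

/-- `‖f - div u‖²` in `L²(Ω)`. The residual is unique up to null sets; if the distribution
`f - div u` is not in `L²(Ω)`, the infimum is over the empty set and the value is `∞`. -/
noncomputable def misfit (Ω : Set Plane) (f : Plane → ℝ) (u : Plane → Plane) : ℝ≥0∞ :=
  ⨅ (r : Plane → ℝ) (_ : IsResidual Ω f u r), eLpNorm r 2 (volume.restrict Ω) ^ 2

/-- The functional `u ↦ ‖u‖_∞ + lam ‖f - div u‖²`, with the Euclidean norm of vectors in
`‖u‖_∞`. -/
noncomputable def functional (Ω : Set Plane) (f : Plane → ℝ) (lam : ℝ) (u : Plane → Plane) :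
    ℝ≥0∞ :=
  eLpNorm u ∞ (volume.restrict Ω) + ENNReal.ofReal lam * misfit Ω f u

/-- `u` minimizes the functional over all of `L^∞(Ω; ℝ²)`. -/
def IsMinimizer (Ω : Set Plane) (f : Plane → ℝ) (lam : ℝ) (u : Plane → Plane) : Prop :=
  MemLp u ∞ (volume.restrict Ω) ∧
    ∀ w : Plane → Plane, MemLp w ∞ (volume.restrict Ω) →
      functional Ω f lam u ≤ functional Ω f lam w

/-- The norm of `L^{2,1}(ℝ²)`, through the distribution function. -/
noncomputable def lorentzNorm (g : Plane → ℝ) : ℝ≥0∞ :=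
  2 * ∫⁻ t in Set.Ioi (0 : ℝ), volume {x | t < |g x|} ^ (1 / 2 : ℝ)

/-- The `L^{2,∞}(ℝ²)` norm of a vector field: the smallest `C` such that
`|{|v| > t}| ≤ C² t⁻²` for all `t > 0`. -/
noncomputable def weakNorm (v : Plane → Plane) : ℝ≥0∞ :=
  sInf {C | ∀ t : ℝ, 0 < t → volume {x | t < ‖v x‖} ≤ C ^ 2 / ENNReal.ofReal t ^ 2}

/-- The constant `β` is admissible in the embedding of `BV(ℝ²)` into `L^{2,1}(ℝ²)`. -/
def IsEmbeddingConst (β : ℝ≥0) : Prop :=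
  ∀ g : Plane → ℝ, MemBV Set.univ g → (MemLp g 1 volume ∨ MemLp g 2 volume) →
    lorentzNorm g ≤ β * totalVariation Set.univ g

/-- The gradient `ψ(x) = x / (2π |x|²)` of the fundamental solution of the Laplacian of `ℝ²`. -/
noncomputable def kernel (x : Plane) : Plane :=
  (1 / (2 * Real.pi * ‖x‖ ^ 2)) • x

/-- The Helmholtz solution `ψ * r`. -/
noncomputable def helmholtz (r : Plane → ℝ) (x : Plane) : Plane :=
  ∫ y, r y • kernel (x - y)

end TwoStep

open MeasureTheory TwoStep

open scoped ENNReal NNReal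

namespace TwoStep

open MeasureTheory Filter Topology

/-! The mechanism is a gain of regularity at a minimizer `u` with residual `r`. Perturbing `u` by `ε
w`, with `w` a test field of norm at most 1, raises `‖u‖_∞` by at most `ε`, while the quadratic term
changes by `-2 ε lam ∫ r div w + O(ε²)`. Minimality and `ε → 0` give `∫ r div w ≤ 1 / (2 lam)`, so
`r` is in BV and not merely in `L²`.

This suffices to solve `div v = r` linearly: BV of the plane embeds in `L^{2,1}`, the kernel `ψ`
lies in `L^{2,∞}`, and these spaces are in duality, so `ψ * r` is bounded. On the plane with `lam =
1 / ‖f‖₂`, comparison with the zero field bounds `‖u‖_∞` by `‖f‖₂`, and the sum `u + ψ * r` solves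
the equation. An open set is handled by extending `f` by zero.

Minimizers exist because the sublevel sets are nested, closed, convex and bounded in a Hilbert space
(`nonempty_iInter_of_antitone_of_convex`). The embedding is proved for smooth functions by applying
the Gagliardo–Nirenberg–Sobolev inequality to truncations at every height and integrating over
heights (`exists_lorentzNorm_le`); mollification and Fatou's lemma carry it to BV. The identity `div
ψ = δ` is a computation in polar coordinates (`integral_fderiv_kernel`). -/

theorem locallyIntegrableOn_of_memLp {E : Type} [NormedAddCommGroup E] {Ω : Set Plane} {p : ℝ≥0∞} {g : Plane → E}
    (hg : MemLp g p (volume.restrict Ω)) (hp : 1 ≤ p) : LocallyIntegrableOn g Ω :=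
  locallyIntegrableOn_of_locallyIntegrable_restrict (hg.locallyIntegrable hp)

/-! ### Calculus of the distributional divergence -/

section WeakDivergence

variable {E F : Type} [NormedAddCommGroup E] [NormedSpace ℝ E] [NormedAddCommGroup F]
  [NormedSpace ℝ F] {Ω : Set Plane}

/-- Serves both sides of the weak identity: `A` is multiplication by `φ` in one case and `∇φ` in the
other. -/
theorem integrable_clm_apply_of_hasCompactSupport {A : Plane → E →L[ℝ] F} {u : Plane → E}
    (hA : Continuous A) (hc : HasCompactSupport A) (hs : tsupport A ⊆ Ω)
    (hu : LocallyIntegrableOn u Ω) : Integrable (fun x => A x (u x)) := by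
  have hsub : Function.support (fun x => A x (u x)) ⊆ tsupport A := by
    intro x hx
    apply subset_tsupport
    intro h
    exact hx (by simp [h])
  rw [← integrableOn_iff_integrable_of_support_subset hsub]
  obtain ⟨C, hC⟩ := hc.exists_bound_of_continuous hA
  have hu' : IntegrableOn u (tsupport A) := hu.integrableOn_compact_subset hs hc
  refine (hu'.norm.const_mul C).mono' ?_ (Eventually.of_forall fun x => ?_)
  · exact (ContinuousLinearMap.id ℝ (E →L[ℝ] F)).aestronglyMeasurable_comp₂
      hA.aestronglyMeasurable hu'.aestronglyMeasurable
  · exact ((A x).le_opNorm _).trans (mul_le_mul_of_nonneg_right (hC x) (norm_nonneg _))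

theorem IsTest.continuous {φ : Plane → F} (hφ : IsTest Ω φ) : Continuous φ := hφ.1.continuous

theorem IsTest.differentiable {φ : Plane → F} (hφ : IsTest Ω φ) : Differentiable ℝ φ :=
  hφ.1.differentiable (by simp)

theorem IsTest.continuous_fderiv {φ : Plane → F} (hφ : IsTest Ω φ) : Continuous (fderiv ℝ φ) :=
  hφ.1.continuous_fderiv (by simp)

theorem IsTest.mono {Ω' : Set Plane} {φ : Plane → F} (hφ : IsTest Ω φ) (h : Ω ⊆ Ω') :
    IsTest Ω' φ := ⟨hφ.1, hφ.2.1, hφ.2.2.trans h⟩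

theorem IsTest.eq_zero {φ : Plane → F} (hφ : IsTest Ω φ) {x : Plane} (hx : x ∉ Ω) : φ x = 0 :=
  image_eq_zero_of_notMem_tsupport fun h => hx (hφ.2.2 h)

theorem IsTest.fderiv_eq_zero {φ : Plane → F} (hφ : IsTest Ω φ) {x : Plane} (hx : x ∉ Ω) :
    fderiv ℝ φ x = 0 :=
  image_eq_zero_of_notMem_tsupport fun h => hx (hφ.2.2 (tsupport_fderiv_subset ℝ h))

theorem IsTest.integrable_mul {φ g : Plane → ℝ} (hφ : IsTest Ω φ)
    (hg : LocallyIntegrableOn g Ω) : Integrable (fun x => g x * φ x) := by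
  have h := integrable_clm_apply_of_hasCompactSupport (Ω := Ω)
    (A := fun x => ContinuousLinearMap.mul ℝ ℝ (φ x)) (u := g)
    ((ContinuousLinearMap.mul ℝ ℝ).continuous.comp hφ.continuous)
    (hφ.2.1.comp_left (g := ContinuousLinearMap.mul ℝ ℝ) (map_zero _))
    ((closure_mono (Function.support_comp_subset (map_zero (ContinuousLinearMap.mul ℝ ℝ)) φ)).trans
      hφ.2.2) hg
  refine h.congr (Eventually.of_forall fun x => ?_)
  simp [mul_comm]

theorem IsTest.integrable_fderiv {φ : Plane → ℝ} {u : Plane → Plane} (hφ : IsTest Ω φ)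
    (hu : LocallyIntegrableOn u Ω) : Integrable (fun x => fderiv ℝ φ x (u x)) :=
  integrable_clm_apply_of_hasCompactSupport hφ.continuous_fderiv (hφ.2.1.fderiv ℝ)
    ((tsupport_fderiv_subset ℝ).trans hφ.2.2) hu

theorem IsTest.setIntegral_mul {φ g : Plane → ℝ} (hφ : IsTest Ω φ) :
    ∫ x in Ω, g x * φ x = ∫ x, g x * φ x :=
  setIntegral_eq_integral_of_forall_compl_eq_zero fun x hx => by simp [hφ.eq_zero hx]

theorem IsTest.setIntegral_fderiv {φ : Plane → ℝ} {u : Plane → Plane} (hφ : IsTest Ω φ) :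
    ∫ x in Ω, fderiv ℝ φ x (u x) = ∫ x, fderiv ℝ φ x (u x) :=
  setIntegral_eq_integral_of_forall_compl_eq_zero fun x hx => by simp [hφ.fderiv_eq_zero hx]

theorem continuous_divergence {w : Plane → Plane} (hw : IsTest Ω w) :
    Continuous (divergence w) := by
  have := hw.continuous_fderiv
  unfold divergence
  fun_prop

theorem hasCompactSupport_divergence {w : Plane → Plane} (hw : IsTest Ω w) :
    HasCompactSupport (divergence w) := by
  refine (hw.2.1.fderiv ℝ).mono fun x hx h => hx ?_
  simp [divergence, h]

theorem IsWeakDiv.add {u v : Plane → Plane} {g h : Plane → ℝ} (hu : IsWeakDiv Ω u g)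
    (hv : IsWeakDiv Ω v h) : IsWeakDiv Ω (fun x => u x + v x) (fun x => g x + h x) := by
  refine ⟨hu.1.add hv.1, hu.2.1.add hv.2.1, fun φ hφ => ?_⟩
  simp only [add_mul, map_add]
  rw [integral_add (hφ.integrable_mul hu.2.1).integrableOn
      (hφ.integrable_mul hv.2.1).integrableOn,
    integral_add (hφ.integrable_fderiv hu.1).integrableOn
      (hφ.integrable_fderiv hv.1).integrableOn, hu.2.2 φ hφ, hv.2.2 φ hφ]
  ring

theorem IsWeakDiv.smul {u : Plane → Plane} {g : Plane → ℝ} (hu : IsWeakDiv Ω u g) (c : ℝ) :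
    IsWeakDiv Ω (fun x => c • u x) (fun x => c * g x) := by
  refine ⟨hu.1.smul c, hu.2.1.smul c, fun φ hφ => ?_⟩
  simp only [mul_assoc, map_smul, smul_eq_mul, integral_const_mul, hu.2.2 φ hφ]
  ring

theorem IsWeakDiv.congr_right {u : Plane → Plane} {g h : Plane → ℝ} (hu : IsWeakDiv Ω u g)
    (hgh : ∀ x, g x = h x) : IsWeakDiv Ω u h := by
  rwa [← show g = h from funext hgh]

theorem IsWeakDiv.mono {Ω' : Set Plane} {u : Plane → Plane} {g : Plane → ℝ}
    (hu : IsWeakDiv Ω' u g) (h : Ω ⊆ Ω') : IsWeakDiv Ω u g := by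
  refine ⟨hu.1.mono_set h, hu.2.1.mono_set h, fun φ hφ => ?_⟩
  have := hu.2.2 φ (hφ.mono h)
  rwa [(hφ.mono h).setIntegral_mul, (hφ.mono h).setIntegral_fderiv, ← hφ.setIntegral_mul,
    ← hφ.setIntegral_fderiv] at this

theorem IsWeakDiv.congr_ae {u v : Plane → Plane} {g h : Plane → ℝ} (hu : IsWeakDiv Ω u g)
    (huv : u =ᵐ[volume.restrict Ω] v) (hgh : g =ᵐ[volume.restrict Ω] h) :
    IsWeakDiv Ω v h := by
  refine ⟨(locallyIntegrableOn_congr huv).1 hu.1, (locallyIntegrableOn_congr hgh).1 hu.2.1,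
    fun φ hφ => ?_⟩
  have e₁ : ∫ x in Ω, g x * φ x = ∫ x in Ω, h x * φ x :=
    integral_congr_ae (hgh.mono fun x hx => by simp only [hx])
  have e₂ : ∫ x in Ω, fderiv ℝ φ x (u x) = ∫ x in Ω, fderiv ℝ φ x (v x) :=
    integral_congr_ae (huv.mono fun x hx => by simp only [hx])
  rw [← e₁, ← e₂, hu.2.2 φ hφ]

theorem isWeakDiv_zero : IsWeakDiv Ω (fun _ => 0) (fun _ => 0) :=
  ⟨locallyIntegrable_zero.locallyIntegrableOn _, locallyIntegrable_zero.locallyIntegrableOn _,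
    fun φ _ => by simp⟩

/-- The fundamental lemma of the calculus of variations. It makes residuals unique up to null sets,
so the infimum in `misfit` runs over a single class. -/
theorem IsWeakDiv.ae_eq {u : Plane → Plane} {g h : Plane → ℝ} (hΩ : IsOpen Ω)
    (hg : IsWeakDiv Ω u g) (hh : IsWeakDiv Ω u h) : g =ᵐ[volume.restrict Ω] h := by
  have := hΩ.ae_eq_zero_of_integral_contDiff_smul_eq_zero (hg.2.1.sub hh.2.1) fun φ h1 h2 h3 => by
    have hφ : IsTest Ω φ := ⟨h1, h2, h3⟩
    have e1 := hg.2.2 φ hφ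
    rw [← hh.2.2 φ hφ, hφ.setIntegral_mul, hφ.setIntegral_mul] at e1
    simp only [Pi.sub_apply, smul_eq_mul, mul_sub]
    rw [integral_sub]
    · simpa [mul_comm, sub_eq_zero] using e1
    · simpa [mul_comm] using hφ.integrable_mul hg.2.1
    · simpa [mul_comm] using hφ.integrable_mul hh.2.1
  refine (ae_restrict_iff' hΩ.measurableSet).2 (this.mono fun x hx hxΩ => ?_)
  simpa [sub_eq_zero] using hx hxΩ

theorem IsResidual.ae_eq {f : Plane → ℝ} {u : Plane → Plane} {r s : Plane → ℝ} (hΩ : IsOpen Ω)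
    (hr : IsResidual Ω f u r) (hs : IsResidual Ω f u s) : r =ᵐ[volume.restrict Ω] s :=
  (hr.2.ae_eq hΩ hs.2).mono fun x hx => by linarith

theorem misfit_eq {f : Plane → ℝ} {u : Plane → Plane} {r : Plane → ℝ} (hΩ : IsOpen Ω)
    (hr : IsResidual Ω f u r) : misfit Ω f u = eLpNorm r 2 (volume.restrict Ω) ^ 2 :=
  le_antisymm (iInf₂_le r hr) (le_iInf₂ fun _ hs => by
    rw [eLpNorm_congr_ae (hr.ae_eq hΩ hs)])

theorem exists_isResidual_of_misfit_lt_top {f : Plane → ℝ} {u : Plane → Plane}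
    (h : misfit Ω f u < ∞) : ∃ r, IsResidual Ω f u r := by
  by_contra! H
  simp [misfit, H] at h

theorem integral_divergence_mul {w : Plane → Plane} {φ : Plane → ℝ}
    (hw : ContDiff ℝ 1 w) (hφ : ContDiff ℝ 1 φ) (hc : HasCompactSupport φ) :
    ∫ x, divergence w x * φ x = - ∫ x, fderiv ℝ φ x (w x) := by
  have hwd : Differentiable ℝ w := hw.differentiable (by simp)
  have hwc : Continuous (fderiv ℝ w) := hw.continuous_fderiv (by simp)
  have hφd : Differentiable ℝ φ := hφ.differentiable (by simp)
  have hφc : Continuous (fderiv ℝ φ) := hφ.continuous_fderiv (by simp)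
  have hw0 := hw.continuous
  have hφ0 := hφ.continuous
  have hderiv : ∀ (i : Fin 2) x v, fderiv ℝ (fun y => w y i) x v = fderiv ℝ w x v i := by
    intro i x v
    have : HasFDerivAt (fun y => w y i)
        ((EuclideanSpace.proj i : Plane →L[ℝ] ℝ).comp (fderiv ℝ w x)) x :=
      (EuclideanSpace.proj i : Plane →L[ℝ] ℝ).hasFDerivAt.comp x (hwd x).hasFDerivAt
    rw [this.fderiv]; rfl
  have h1 : ∀ i : Fin 2, Integrable fun x =>
      fderiv ℝ w x (EuclideanSpace.single i 1) i * φ x := fun i =>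
    Continuous.integrable_of_hasCompactSupport (by fun_prop) (hc.mul_left)
  have h2 : ∀ i : Fin 2, Integrable fun x =>
      w x i * fderiv ℝ φ x (EuclideanSpace.single i 1) := fun i =>
    Continuous.integrable_of_hasCompactSupport (by fun_prop) ((hc.fderiv_apply ℝ _).mul_left)
  have h3 : ∀ i : Fin 2, Integrable fun x => w x i * φ x := fun i =>
    Continuous.integrable_of_hasCompactSupport (by fun_prop) (hc.mul_left)
  have key : ∀ i : Fin 2, ∫ x, fderiv ℝ w x (EuclideanSpace.single i 1) i * φ x =
      - ∫ x, w x i * fderiv ℝ φ x (EuclideanSpace.single i 1) := by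
    intro i
    have := integral_mul_fderiv_eq_neg_fderiv_mul_of_integrable (μ := (volume : Measure Plane))
      (f := fun y => w y i) (g := φ) (v := EuclideanSpace.single i 1) (by simpa only [hderiv] using h1 i)
      (h2 i) (h3 i) (fun x _ => by fun_prop) (fun x _ => hφd x)
    simp only [hderiv] at this
    rw [this, neg_neg]
  have hsum : ∀ x, fderiv ℝ φ x (w x) =
      ∑ i : Fin 2, w x i * fderiv ℝ φ x (EuclideanSpace.single i 1) := by
    intro x
    conv_lhs => rw [← (EuclideanSpace.basisFun (Fin 2) ℝ).sum_repr (w x)]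
    simp
  simp only [divergence, hsum, Finset.sum_mul]
  rw [integral_finsetSum _ fun i _ => h1 i, integral_finsetSum _ fun i _ => h2 i,
    ← Finset.sum_neg_distrib]
  exact Finset.sum_congr rfl fun i _ => key i

theorem IsTest.isWeakDiv {Ω' : Set Plane} {w : Plane → Plane} (hw : IsTest Ω' w) :
    IsWeakDiv Ω w (divergence w) := by
  refine ⟨hw.continuous.locallyIntegrable.locallyIntegrableOn _,
    (continuous_divergence hw).locallyIntegrable.locallyIntegrableOn _, fun φ hφ => ?_⟩
  rw [hφ.setIntegral_mul, hφ.setIntegral_fderiv]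
  exact integral_divergence_mul (hw.1.of_le (by exact_mod_cast le_top))
    (hφ.1.of_le (by exact_mod_cast le_top)) hφ.2.1

end WeakDivergence

/-! ### First variation at a minimizer and the BV bound -/

section Variation

variable {Ω : Set Plane} {f : Plane → ℝ} {lam : ℝ} {u : Plane → Plane} {r : Plane → ℝ}

theorem eLpNorm_two_sq {α : Type*} [MeasurableSpace α] {μ : Measure α} {g : α → ℝ}
    (hg : MemLp g 2 μ) : eLpNorm g 2 μ ^ 2 = ENNReal.ofReal (∫ x, g x ^ 2 ∂μ) := by
  have h := eLpNorm_nnreal_pow_eq_lintegral (μ := μ) (f := g) (p := 2) (by norm_num)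
  have e : ((2 : ℝ≥0) : ℝ) = ((2 : ℕ) : ℝ) := by norm_num
  rw [e] at h
  simp only [ENNReal.rpow_natCast] at h
  rw [ofReal_integral_eq_lintegral_ofReal hg.integrable_sq
    (Eventually.of_forall fun x => sq_nonneg (g x))]
  refine (Eq.trans ?_ h).trans (lintegral_congr fun x => ?_)
  · norm_num
  · rw [← enorm_pow, Real.enorm_eq_ofReal (sq_nonneg _)]

theorem functional_eq (hΩ : IsOpen Ω) (hr : IsResidual Ω f u r) :
    functional Ω f lam u = eLpNorm u ∞ (volume.restrict Ω) +
      ENNReal.ofReal lam * eLpNorm r 2 (volume.restrict Ω) ^ 2 := by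
  rw [functional, misfit_eq hΩ hr]

theorem isResidual_zero (hf : MemLp f 2 (volume.restrict Ω)) :
    IsResidual Ω f (fun _ => 0) f :=
  ⟨hf, isWeakDiv_zero.congr_right fun x => by ring⟩

theorem functional_zero (hΩ : IsOpen Ω) (hf : MemLp f 2 (volume.restrict Ω)) :
    functional Ω f lam (fun _ => 0) =
      ENNReal.ofReal lam * eLpNorm f 2 (volume.restrict Ω) ^ 2 := by
  rw [functional_eq hΩ (isResidual_zero hf), show (fun _ : Plane => (0 : Plane)) = 0 from rfl,
    eLpNorm_zero, zero_add]

theorem functional_zero_lt_top (hΩ : IsOpen Ω) (hf : MemLp f 2 (volume.restrict Ω)) :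
    functional Ω f lam (fun _ => 0) < ∞ := by
  rw [functional_zero hΩ hf]
  exact ENNReal.mul_lt_top ENNReal.ofReal_lt_top (ENNReal.pow_lt_top hf.eLpNorm_lt_top)

/-- Positivity of `lam` matters: `0 * ∞ = 0` would hide an infinite misfit. -/
theorem exists_isResidual_of_functional_lt_top (hlam : 0 < lam)
    (h : functional Ω f lam u < ∞) : ∃ r, IsResidual Ω f u r := by
  apply exists_isResidual_of_misfit_lt_top
  rw [functional, ENNReal.add_lt_top] at h
  exact ENNReal.lt_top_of_mul_ne_top_right h.2.ne (by simpa using hlam)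

theorem IsMinimizer.le_zero (hu : IsMinimizer Ω f lam u) :
    functional Ω f lam u ≤ functional Ω f lam (fun _ => 0) :=
  hu.2 _ MemLp.zero

theorem IsMinimizer.exists_isResidual (hΩ : IsOpen Ω) (hf : MemLp f 2 (volume.restrict Ω))
    (hlam : 0 < lam) (hu : IsMinimizer Ω f lam u) : ∃ r, IsResidual Ω f u r :=
  exists_isResidual_of_functional_lt_top hlam
    (hu.le_zero.trans_lt (functional_zero_lt_top hΩ hf))

theorem IsResidual.add_smul_test {w : Plane → Plane} {Ω' : Set Plane} (hr : IsResidual Ω f u r)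
    (hw : IsTest Ω' w) (ε : ℝ) :
    IsResidual Ω f (fun x => u x + ε • w x) (fun x => r x - ε * divergence w x) := by
  refine ⟨hr.1.sub (MemLp.const_mul ?_ ε), (hr.2.add (hw.isWeakDiv.smul ε)).congr_right
    fun x => by ring⟩
  exact ((continuous_divergence hw).memLp_of_hasCompactSupport
    (hasCompactSupport_divergence hw)).restrict _

theorem IsMinimizer.integral_mul_divergence_le (hΩ : IsOpen Ω) (hlam : 0 < lam)
    (hu : IsMinimizer Ω f lam u) (hr : IsResidual Ω f u r) {w : Plane → Plane}
    (hw : IsTest Ω w) (hw1 : ∀ x, ‖w x‖ ≤ 1) :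
    ∫ x in Ω, r x * divergence w x ≤ 1 / (2 * lam) := by
  set d := divergence w
  have hd : MemLp d 2 (volume.restrict Ω) :=
    ((continuous_divergence hw).memLp_of_hasCompactSupport
      (hasCompactSupport_divergence hw)).restrict _
  have hw' : MemLp w ∞ (volume.restrict Ω) :=
    memLp_top_of_bound hw.continuous.aestronglyMeasurable 1 (Eventually.of_forall hw1)
  have hwn : eLpNorm w ∞ (volume.restrict Ω) ≤ 1 := by
    rw [eLpNorm_exponent_top]
    refine eLpNormEssSup_le_of_ae_enorm_bound (Eventually.of_forall fun x => ?_)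
    rw [← ofReal_norm]
    exact ENNReal.ofReal_le_one.2 (hw1 x)
  -- Compare `u` with `u + ε w`, cancel the finite number `‖u‖_∞`, expand the square and divide by
  -- `ε`.
  have key : ∀ ε : ℝ, 0 < ε →
      2 * lam * ∫ x in Ω, r x * d x ≤ 1 + ε * (lam * ∫ x in Ω, d x ^ 2) := by
    intro ε hε
    have hres := hr.add_smul_test hw ε
    have h := hu.2 (fun x => u x + ε • w x) (hu.1.add (hw'.const_smul ε))
    rw [functional_eq hΩ hr, functional_eq hΩ hres, eLpNorm_two_sq hr.1,
      eLpNorm_two_sq hres.1] at h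
    have h2 : eLpNorm (fun x => u x + ε • w x) ∞ (volume.restrict Ω) ≤
        eLpNorm u ∞ (volume.restrict Ω) + ENNReal.ofReal ε := by
      refine (eLpNorm_add_le hu.1.1 (hw'.const_smul ε).1 le_top).trans ?_
      gcongr
      rw [eLpNorm_const_smul, Real.enorm_eq_ofReal hε.le]
      exact mul_le_of_le_one_right' hwn
    have h3 := h.trans (add_le_add_left h2 _)
    rw [add_assoc, ENNReal.add_le_add_iff_left hu.1.eLpNorm_lt_top.ne,
      ← ENNReal.ofReal_mul hlam.le, ← ENNReal.ofReal_mul hlam.le,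
      ← ENNReal.ofReal_add hε.le (mul_nonneg hlam.le (integral_nonneg fun x => sq_nonneg _)),
      ENNReal.ofReal_le_ofReal_iff
        (add_nonneg hε.le (mul_nonneg hlam.le (integral_nonneg fun x => sq_nonneg _)))] at h3
    have e : ∫ x in Ω, (r x - ε * d x) ^ 2 =
        (∫ x in Ω, r x ^ 2) - 2 * ε * (∫ x in Ω, r x * d x) + ε ^ 2 * ∫ x in Ω, d x ^ 2 := by
      have i1 := hr.1.integrable_sq
      have i2 : Integrable (fun x => r x * d x) (volume.restrict Ω) := hr.1.integrable_mul hd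
      have i3 := hd.integrable_sq
      have i4 : Integrable (fun x => r x ^ 2 - 2 * ε * (r x * d x)) (volume.restrict Ω) :=
        i1.sub (i2.const_mul _)
      rw [← integral_const_mul, ← integral_const_mul, ← integral_sub i1 (i2.const_mul _),
        ← integral_add i4 (i3.const_mul _)]
      congr 1; ext x; ring
    rw [e] at h3
    have : ε * (2 * lam * ∫ x in Ω, r x * d x) ≤ ε * (1 + ε * (lam * ∫ x in Ω, d x ^ 2)) := by
      nlinarith
    exact le_of_mul_le_mul_left this hε
  have hlim : Tendsto (fun ε : ℝ => 1 + ε * (lam * ∫ x in Ω, d x ^ 2)) (𝓝[>] 0) (𝓝 1) := by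
    have : Continuous fun ε : ℝ => 1 + ε * (lam * ∫ x in Ω, d x ^ 2) := by fun_prop
    simpa using (this.tendsto 0).mono_left nhdsWithin_le_nhds
  have := ge_of_tendsto hlim (eventually_mem_nhdsWithin.mono fun ε hε => key ε hε)
  rw [le_div_iff₀ (by positivity)]
  linarith

theorem IsMinimizer.totalVariation_le (hΩ : IsOpen Ω) (hlam : 0 < lam)
    (hu : IsMinimizer Ω f lam u) (hr : IsResidual Ω f u r) :
    totalVariation Ω r ≤ ENNReal.ofReal (1 / (2 * lam)) :=
  iSup₂_le fun _ hw =>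
    ENNReal.ofReal_le_ofReal (hu.integral_mul_divergence_le hΩ hlam hr hw.1 hw.2)

theorem IsMinimizer.memBV (hΩ : IsOpen Ω) (hlam : 0 < lam)
    (hu : IsMinimizer Ω f lam u) (hr : IsResidual Ω f u r) : MemBV Ω r :=
  ⟨locallyIntegrableOn_of_memLp hr.1 (by norm_num),
    (hu.totalVariation_le hΩ hlam hr).trans_lt ENNReal.ofReal_lt_top⟩

end Variation

/-! ### Existence of minimizers by a Hilbert space argument -/

section Existence

/-- A substitute for weak compactness. The points of least norm in the sets `K n` have increasing
bounded norms, and the parallelogram law makes them a Cauchy sequence; the limit lies in every `K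
n`. -/
theorem nonempty_iInter_of_antitone_of_convex {H : Type*} [NormedAddCommGroup H]
    [InnerProductSpace ℝ H] [CompleteSpace H] (K : ℕ → Set H) (hne : ∀ n, (K n).Nonempty)
    (hcl : ∀ n, IsClosed (K n)) (hconv : ∀ n, Convex ℝ (K n)) (hanti : Antitone K) {M : ℝ}
    (hM : ∀ x ∈ K 0, ‖x‖ ≤ M) : (⋂ n, K n).Nonempty := by
  have hmin : ∀ n, ∃ v ∈ K n, ∀ w ∈ K n, ‖v‖ ≤ ‖w‖ := by
    intro n
    obtain ⟨v, hv, h⟩ := exists_norm_eq_iInf_of_complete_convex (hne n) (hcl n).isComplete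
      (hconv n) 0
    refine ⟨v, hv, fun w hw => ?_⟩
    simp only [zero_sub, norm_neg] at h
    rw [h]
    exact ciInf_le ⟨0, by rintro _ ⟨y, rfl⟩; exact norm_nonneg _⟩ (⟨w, hw⟩ : K n)
  choose v hv hvmin using hmin
  have hmono : Monotone fun n => ‖v n‖ ^ 2 := fun m n hmn =>
    pow_le_pow_left₀ (norm_nonneg _) (hvmin m _ (hanti hmn (hv n))) 2
  have hbdd : BddAbove (Set.range fun n => ‖v n‖ ^ 2) := by
    refine ⟨M ^ 2, ?_⟩
    rintro _ ⟨n, rfl⟩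
    exact pow_le_pow_left₀ (norm_nonneg _) (hM _ (hanti (Nat.zero_le n) (hv n))) 2
  have hlim := tendsto_atTop_ciSup hmono hbdd
  set S := ⨆ n, ‖v n‖ ^ 2
  have hest : ∀ m n, m ≤ n → ‖v n - v m‖ ^ 2 ≤ 2 * (S - ‖v m‖ ^ 2) := by
    intro m n hmn
    -- By convexity the midpoint cannot have norm below `‖v m‖`, which bounds `‖v n + v m‖` from
    -- below in the parallelogram law.
    have hmid : (1 / 2 : ℝ) • v n + (1 / 2 : ℝ) • v m ∈ K m :=
      hconv m (hanti hmn (hv n)) (hv m) (by norm_num) (by norm_num) (by norm_num)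
    have h1 := hvmin m _ hmid
    rw [← smul_add, norm_smul, Real.norm_of_nonneg (by norm_num : (0 : ℝ) ≤ 1 / 2)] at h1
    have h2 := parallelogram_law_with_norm ℝ (v n) (v m)
    have h3 : ‖v n‖ ^ 2 ≤ S := le_ciSup hbdd n
    have h4 : (2 * ‖v m‖) ^ 2 ≤ ‖v n + v m‖ ^ 2 :=
      pow_le_pow_left₀ (by positivity) (by linarith) 2
    nlinarith
  have hcauchy : CauchySeq v := by
    rw [Metric.cauchySeq_iff']
    intro ε hε
    have h0 : Tendsto (fun m => 2 * (S - ‖v m‖ ^ 2)) atTop (𝓝 0) := by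
      simpa using (hlim.const_sub S).const_mul 2
    obtain ⟨N, hN⟩ := (h0.eventually (gt_mem_nhds (show (0 : ℝ) < ε ^ 2 by positivity))).exists
    refine ⟨N, fun n hn => ?_⟩
    rw [dist_eq_norm]
    exact lt_of_pow_lt_pow_left₀ 2 hε.le ((hest N n hn).trans_lt hN)
  obtain ⟨x, hx⟩ := cauchySeq_tendsto_of_complete hcauchy
  refine ⟨x, Set.mem_iInter.2 fun n => (hcl n).mem_of_tendsto hx ?_⟩
  filter_upwards [eventually_ge_atTop n] with k hk using hanti hk (hv k)

/-- Pairs of a residual and a field, as a Hilbert space; the field is measured with a finite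
measure which has the same null sets as Lebesgue measure on `Ω`. -/
abbrev PairSpace (Ω : Set Plane) : Type :=
  WithLp 2 (Lp ℝ 2 (volume.restrict Ω : Measure Plane) ×
    Lp Plane 2 (volume.restrict Ω : Measure Plane).toFinite)

/-- The pairs at which the functional is at most `c`. -/
def sublevel (Ω : Set Plane) (f : Plane → ℝ) (lam c : ℝ) : Set (PairSpace Ω) :=
  {z | lam * ‖z.fst‖ ^ 2 ≤ c ∧ (∀ᵐ x ∂volume.restrict Ω, ‖z.snd x‖ + lam * ‖z.fst‖ ^ 2 ≤ c) ∧
    IsWeakDiv Ω z.snd (fun x => f x - z.fst x)}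

variable {Ω : Set Plane} {f : Plane → ℝ} {lam : ℝ}

theorem aestronglyMeasurable_snd (z : PairSpace Ω) :
    AEStronglyMeasurable z.snd (volume.restrict Ω) :=
  (Lp.aestronglyMeasurable z.snd).mono_ac (absolutelyContinuous_toFinite _)

theorem ae_eq_of_ae_eq_toFinite {E : Type*} {u v : Plane → E}
    (h : u =ᵐ[(volume.restrict Ω).toFinite] v) : u =ᵐ[volume.restrict Ω] v := by
  rwa [EventuallyEq, ae_toFinite] at h

theorem convex_sublevel (hlam : 0 ≤ lam) (c : ℝ) : Convex ℝ (sublevel Ω f lam c) := by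
  intro x hx y hy a b ha hb hab
  have hsq : ‖a • x.fst + b • y.fst‖ ^ 2 ≤ a * ‖x.fst‖ ^ 2 + b * ‖y.fst‖ ^ 2 := by
    have h1 : ‖a • x.fst + b • y.fst‖ ≤ a * ‖x.fst‖ + b * ‖y.fst‖ := by
      refine (norm_add_le _ _).trans ?_
      rw [norm_smul, norm_smul, Real.norm_of_nonneg ha, Real.norm_of_nonneg hb]
    have h2 := pow_le_pow_left₀ (norm_nonneg _) h1 2
    refine h2.trans ?_
    have : b = 1 - a := by linarith
    subst this
    -- With `a + b = 1`, `a p² + b q² - (a p + b q)² = a b (p - q)²`.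
    nlinarith [mul_nonneg (mul_nonneg ha hb) (sq_nonneg (‖x.fst‖ - ‖y.fst‖))]
  have hsq' := mul_le_mul_of_nonneg_left hsq hlam
  have hfst : ⇑(a • x.fst + b • y.fst) =ᵐ[volume.restrict Ω]
      fun t => a * x.fst t + b * y.fst t := by
    filter_upwards [Lp.coeFn_add (a • x.fst) (b • y.fst), Lp.coeFn_smul a x.fst,
      Lp.coeFn_smul b y.fst] with t h1 h2 h3
    rw [h1, Pi.add_apply, h2, h3]
    rfl
  have hsnd : ⇑(a • x.snd + b • y.snd) =ᵐ[volume.restrict Ω]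
      fun t => a • x.snd t + b • y.snd t := by
    apply ae_eq_of_ae_eq_toFinite
    filter_upwards [Lp.coeFn_add (a • x.snd) (b • y.snd), Lp.coeFn_smul a x.snd,
      Lp.coeFn_smul b y.snd] with t h1 h2 h3
    rw [h1, Pi.add_apply, h2, h3]
    rfl
  refine ⟨?_, ?_, ?_⟩
  · change lam * ‖a • x.fst + b • y.fst‖ ^ 2 ≤ c
    have h1 := mul_le_mul_of_nonneg_left hx.1 ha
    have h2 := mul_le_mul_of_nonneg_left hy.1 hb
    have : c = a * c + b * c := by rw [← add_mul, hab, one_mul]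
    linarith
  · change ∀ᵐ t ∂volume.restrict Ω,
      ‖(a • x.snd + b • y.snd) t‖ + lam * ‖a • x.fst + b • y.fst‖ ^ 2 ≤ c
    filter_upwards [hsnd, hx.2.1, hy.2.1] with t h1 h2 h3
    have h4 : ‖a • x.snd t + b • y.snd t‖ ≤ a * ‖x.snd t‖ + b * ‖y.snd t‖ := by
      refine (norm_add_le _ _).trans ?_
      rw [norm_smul, norm_smul, Real.norm_of_nonneg ha, Real.norm_of_nonneg hb]
    rw [h1]
    have h5 := mul_le_mul_of_nonneg_left h2 ha
    have h6 := mul_le_mul_of_nonneg_left h3 hb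
    have : c = a * c + b * c := by rw [← add_mul, hab, one_mul]
    linarith
  · change IsWeakDiv Ω (⇑(a • x.snd + b • y.snd))
      (fun t => f t - (a • x.fst + b • y.fst) t)
    refine ((hx.2.2.smul a).add (hy.2.2.smul b)).congr_ae hsnd.symm ?_
    filter_upwards [hfst] with t ht
    rw [ht]
    linear_combination f t * hab

/-- The finite measure on the second factor turns the uniform bound on the field into an `L²` bound,
even when `Ω` has infinite area. -/
theorem exists_norm_le_of_mem_sublevel (hlam : 0 < lam) {c : ℝ} (hc : 0 ≤ c) :
    ∃ M, ∀ z ∈ sublevel Ω f lam c, ‖z‖ ≤ M := by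
  set B := (volume.restrict Ω : Measure Plane).toFinite.real Set.univ ^ ((2 : ℝ≥0∞).toReal)⁻¹ * c
  refine ⟨√(c / lam + B ^ 2), fun z hz => Real.le_sqrt_of_sq_le ?_⟩
  rw [WithLp.prod_norm_sq_eq_of_L2]
  have h1 : ‖z.fst‖ ^ 2 ≤ c / lam := by
    rw [le_div_iff₀ hlam, mul_comm]
    exact hz.1
  have h2 : ‖z.snd‖ ≤ B := by
    refine Lp.norm_le_of_ae_bound hc ?_
    rw [ae_toFinite]
    filter_upwards [hz.2.1] with t ht
    nlinarith [mul_nonneg hlam.le (sq_nonneg ‖z.fst‖)]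
  exact add_le_add h1 (pow_le_pow_left₀ (norm_nonneg _) h2 2)

theorem locallyIntegrableOn_of_ae_bound {u : Plane → Plane} {C : ℝ}
    (hu : AEStronglyMeasurable u (volume.restrict Ω))
    (h : ∀ᵐ x ∂volume.restrict Ω, ‖u x‖ ≤ C) : LocallyIntegrableOn u Ω :=
  locallyIntegrableOn_of_memLp (memLp_top_of_bound hu C h) le_top

/-- Along a subsequence the fields converge almost everywhere, which preserves their pointwise
bound; dominated convergence with majorant `c ‖∇φ‖` then passes to the limit in the field term. The
residual term is an `L²` inner product with `φ`, hence continuous. -/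
theorem isClosed_sublevel (hf : MemLp f 2 (volume.restrict Ω))
    (hlam : 0 < lam) (c : ℝ) : IsClosed (sublevel Ω f lam c) := by
  refine isClosed_of_closure_subset fun z hz => ?_
  obtain ⟨x, hx, hxz⟩ := mem_closure_iff_seq_limit.1 hz
  have hfst : Tendsto (fun n => (x n).fst) atTop (𝓝 z.fst) :=
    ((WithLp.continuous_fst 2 _ _).tendsto z).comp hxz
  have hsnd : Tendsto (fun n => (x n).snd) atTop (𝓝 z.snd) :=
    ((WithLp.continuous_snd 2 _ _).tendsto z).comp hxz
  have hnorm : Tendsto (fun n => lam * ‖(x n).fst‖ ^ 2) atTop (𝓝 (lam * ‖z.fst‖ ^ 2)) :=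
    (hfst.norm.pow 2).const_mul lam
  obtain ⟨ns, hns, hae⟩ := (tendstoInMeasure_of_tendsto_Lp hsnd).exists_seq_tendsto_ae
  rw [ae_toFinite] at hae
  have hbound : ∀ᵐ t ∂volume.restrict Ω, ‖z.snd t‖ + lam * ‖z.fst‖ ^ 2 ≤ c := by
    filter_upwards [hae, ae_all_iff.2 fun n => (hx n).2.1] with t h1 h2
    exact le_of_tendsto' (h1.norm.add (hnorm.comp hns.tendsto_atTop)) fun n => h2 (ns n)
  have hbd : ∀ y : PairSpace Ω, (∀ᵐ t ∂volume.restrict Ω, ‖y.snd t‖ + lam * ‖y.fst‖ ^ 2 ≤ c) →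
      ∀ᵐ t ∂volume.restrict Ω, ‖y.snd t‖ ≤ c := fun y hy => by
    filter_upwards [hy] with t ht
    nlinarith [mul_nonneg hlam.le (sq_nonneg ‖y.fst‖)]
  have hloc : ∀ y : PairSpace Ω, LocallyIntegrableOn (fun t => f t - y.fst t) Ω := fun y =>
    locallyIntegrableOn_of_memLp (hf.sub (Lp.memLp y.fst)) (by norm_num)
  refine ⟨le_of_tendsto' hnorm fun n => (hx n).1, hbound,
    locallyIntegrableOn_of_ae_bound (aestronglyMeasurable_snd z) (hbd z hbound),
    hloc z, fun φ hφ => ?_⟩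
  have hφ2 : MemLp φ 2 (volume.restrict Ω) :=
    (hφ.continuous.memLp_of_hasCompactSupport hφ.2.1).restrict _
  have hpair : ∀ y : PairSpace Ω, ∫ t in Ω, (f t - y.fst t) * φ t =
      (∫ t in Ω, f t * φ t) - inner ℝ (hφ2.toLp φ) y.fst := by
    intro y
    rw [L2.inner_def, ← integral_sub]
    · refine integral_congr_ae ?_
      filter_upwards [hφ2.coeFn_toLp] with t ht
      simp [ht]
      ring
    · exact hf.integrable_mul hφ2
    · exact L2.integrable_inner _ _
  have hL : Tendsto (fun n => ∫ t in Ω, (f t - (x (ns n)).fst t) * φ t) atTop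
      (𝓝 (∫ t in Ω, (f t - z.fst t) * φ t)) := by
    simp only [hpair]
    exact (tendsto_const_nhds.inner (hfst.comp hns.tendsto_atTop)).const_sub _
  have hR : Tendsto (fun n => ∫ t in Ω, fderiv ℝ φ t ((x (ns n)).snd t)) atTop
      (𝓝 (∫ t in Ω, fderiv ℝ φ t (z.snd t))) := by
    refine tendsto_integral_of_dominated_convergence (fun t => ‖fderiv ℝ φ t‖ * c)
      (fun n => (hφ.integrable_fderiv (hx (ns n)).2.2.1).aestronglyMeasurable.restrict) ?_ ?_ ?_
    · exact (((hφ.continuous_fderiv.norm.integrable_of_hasCompactSupport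
        (hφ.2.1.fderiv ℝ).norm).mul_const c).restrict)
    · intro n
      filter_upwards [hbd _ (hx (ns n)).2.1] with t ht
      exact ((fderiv ℝ φ t).le_opNorm _).trans (mul_le_mul_of_nonneg_left ht (norm_nonneg _))
    · filter_upwards [hae] with t ht
      exact ((fderiv ℝ φ t).continuous.tendsto _).comp ht
  refine tendsto_nhds_unique hL ?_
  simp only [fun n => (hx (ns n)).2.2.2.2 φ hφ]
  exact hR.neg

theorem functional_le_of_mem_sublevel (hΩ : IsOpen Ω) (hlam : 0 < lam) {c : ℝ}
    {z : PairSpace Ω} (hz : z ∈ sublevel Ω f lam c) :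
    MemLp z.snd ∞ (volume.restrict Ω) ∧ functional Ω f lam z.snd ≤ ENNReal.ofReal c := by
  have hb : ∀ᵐ t ∂volume.restrict Ω, ‖z.snd t‖ ≤ c - lam * ‖z.fst‖ ^ 2 := by
    filter_upwards [hz.2.1] with t ht
    linarith
  refine ⟨memLp_top_of_bound (aestronglyMeasurable_snd z) _ hb, ?_⟩
  have hr : IsResidual Ω f z.snd z.fst := ⟨Lp.memLp z.fst, hz.2.2⟩
  have h1 : eLpNorm z.snd ∞ (volume.restrict Ω) ≤ ENNReal.ofReal (c - lam * ‖z.fst‖ ^ 2) := by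
    rw [eLpNorm_exponent_top]
    refine eLpNormEssSup_le_of_ae_enorm_bound (hb.mono fun t ht => ?_)
    rw [← ofReal_norm]
    exact ENNReal.ofReal_le_ofReal ht
  have h2 : eLpNorm z.fst 2 (volume.restrict Ω) = ENNReal.ofReal ‖z.fst‖ := by
    rw [Lp.norm_def, ENNReal.ofReal_toReal (Lp.eLpNorm_ne_top _)]
  rw [functional_eq hΩ hr, h2, ← ENNReal.ofReal_pow (norm_nonneg _), ← ENNReal.ofReal_mul hlam.le]
  refine (add_le_add_left h1 _).trans ?_
  -- The separate first clause of `sublevel` is needed here: if `Ω` is null, the almost everywhere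
  -- bound says nothing about the sign of `c - lam * ‖z.fst‖ ^ 2`.
  rw [← ENNReal.ofReal_add (by linarith [hz.1]) (mul_nonneg hlam.le (sq_nonneg _))]
  exact ENNReal.ofReal_le_ofReal (by linarith)

theorem nonempty_sublevel (hΩ : IsOpen Ω) (hlam : 0 < lam) {c : ℝ} {w : Plane → Plane}
    (hw : MemLp w ∞ (volume.restrict Ω)) (h : functional Ω f lam w < ENNReal.ofReal c) :
    (sublevel Ω f lam c).Nonempty := by
  obtain ⟨r, hr⟩ := exists_isResidual_of_functional_lt_top hlam (h.trans ENNReal.ofReal_lt_top)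
  rw [functional_eq hΩ hr, ← ENNReal.ofReal_toReal hw.eLpNorm_lt_top.ne,
    ← ENNReal.ofReal_toReal hr.1.eLpNorm_lt_top.ne, ← ENNReal.ofReal_pow ENNReal.toReal_nonneg,
    ← ENNReal.ofReal_mul hlam.le, ← ENNReal.ofReal_add ENNReal.toReal_nonneg (by positivity)] at h
  have hc := (ENNReal.ofReal_lt_ofReal_iff_of_nonneg (by positivity)).1 h
  have hw2 : MemLp w 2 (volume.restrict Ω : Measure Plane).toFinite := by
    have : MemLp w ∞ (volume.restrict Ω : Measure Plane).toFinite :=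
      ⟨hw.1.mono_ac (toFinite_absolutelyContinuous _), by
        rw [eLpNorm_exponent_top]
        refine lt_of_le_of_lt (eLpNormEssSup_mono_measure _ (toFinite_absolutelyContinuous _)) ?_
        rw [← eLpNorm_exponent_top]
        exact hw.2⟩
    exact this.mono_exponent le_top
  have hae := ae_eq_of_ae_eq_toFinite hw2.coeFn_toLp
  have hnorm : ‖hr.1.toLp r‖ = (eLpNorm r 2 (volume.restrict Ω)).toReal := Lp.norm_toLp _ _
  refine ⟨WithLp.toLp 2 (hr.1.toLp r, hw2.toLp w), ?_, ?_, ?_⟩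
  · change lam * ‖hr.1.toLp r‖ ^ 2 ≤ c
    rw [hnorm]
    have : 0 ≤ (eLpNorm w ∞ (volume.restrict Ω)).toReal := ENNReal.toReal_nonneg
    linarith
  · change ∀ᵐ t ∂volume.restrict Ω, ‖hw2.toLp w t‖ + lam * ‖hr.1.toLp r‖ ^ 2 ≤ c
    rw [hnorm]
    filter_upwards [hae, ae_le_eLpNormEssSup (f := w) (μ := volume.restrict Ω)] with t h1 h2
    rw [h1]
    have h3 : ‖w t‖ ≤ (eLpNorm w ∞ (volume.restrict Ω)).toReal := by
      rw [← ENNReal.ofReal_le_iff_le_toReal hw.eLpNorm_lt_top.ne, ofReal_norm,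
        eLpNorm_exponent_top]
      exact h2
    linarith
  · change IsWeakDiv Ω (hw2.toLp w) (fun t => f t - hr.1.toLp r t)
    refine hr.2.congr_ae hae.symm ?_
    filter_upwards [hr.1.coeFn_toLp] with t ht
    rw [ht]

theorem exists_isMinimizer (hΩ : IsOpen Ω) (hf : MemLp f 2 (volume.restrict Ω))
    (hlam : 0 < lam) : ∃ u, IsMinimizer Ω f lam u := by
  set m : ℝ≥0∞ := ⨅ (w : Plane → Plane) (_ : MemLp w ∞ (volume.restrict Ω)), functional Ω f lam w
    with hm
  have hm0 : m ≤ functional Ω f lam (fun _ => 0) :=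
    iInf₂_le (fun _ : Plane => (0 : Plane)) MemLp.zero
  have hmtop : m ≠ ∞ := (hm0.trans_lt (functional_zero_lt_top hΩ hf)).ne
  -- The levels decrease to the infimum `m` and stay strictly above it, so no sublevel set is empty;
  -- a common point of all of them attains `m`.
  set c : ℕ → ℝ := fun n => m.toReal + 1 / ((n : ℝ) + 1) with hcdef
  have hmc : ∀ n, m < ENNReal.ofReal (c n) := fun n => by
    rw [ENNReal.lt_ofReal_iff_toReal_lt hmtop]
    exact lt_add_of_pos_right _ Nat.one_div_pos_of_nat
  have hanti : Antitone c := fun a b hab => by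
    simp only [hcdef]
    gcongr
  obtain ⟨M, hM⟩ := exists_norm_le_of_mem_sublevel (Ω := Ω) (f := f) hlam (c := c 0)
    (add_nonneg ENNReal.toReal_nonneg (by positivity))
  obtain ⟨z, hz⟩ := nonempty_iInter_of_antitone_of_convex (fun n => sublevel Ω f lam (c n))
    (fun n => by
      have h := hmc n
      simp only [hm, iInf_lt_iff] at h
      obtain ⟨w, hw, hlt⟩ := h
      exact nonempty_sublevel hΩ hlam hw hlt)
    (fun n => isClosed_sublevel hf hlam _) (fun n => convex_sublevel hlam.le _)
    (fun a b hab z hz => ⟨hz.1.trans (hanti hab),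
      hz.2.1.mono fun t ht => ht.trans (hanti hab), hz.2.2⟩) hM
  rw [Set.mem_iInter] at hz
  refine ⟨z.snd, (functional_le_of_mem_sublevel hΩ hlam (hz 0)).1, fun w hw => ?_⟩
  have hlim : Tendsto (fun n => ENNReal.ofReal (c n)) atTop (𝓝 m) := by
    rw [← ENNReal.ofReal_toReal hmtop]
    refine ENNReal.tendsto_ofReal ?_
    simpa only [add_zero] using
      (tendsto_one_div_add_atTop_nhds_zero_nat (𝕜 := ℝ)).const_add m.toReal
  exact (ge_of_tendsto' hlim fun n =>
    (functional_le_of_mem_sublevel hΩ hlam (hz n)).2).trans (iInf₂_le w hw)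

end Existence

/-! ### Duality of `L^{2,1}` and `L^{2,∞}`, and boundedness of `ψ * r` -/

section LorentzHolder

/-- The condition on `C` is closed, so the infimum is attained; finiteness ensures that some `C` is
admissible. -/
theorem measure_lt_le_weakNorm {v : Plane → Plane} (hv : weakNorm v < ∞) {t : ℝ} (ht : 0 < t) :
    volume {x | t < ‖v x‖} ≤ weakNorm v ^ 2 / ENNReal.ofReal t ^ 2 := by
  have hne : {C : ℝ≥0∞ | ∀ t : ℝ, 0 < t →
      volume {x | t < ‖v x‖} ≤ C ^ 2 / ENNReal.ofReal t ^ 2}.Nonempty := by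
    by_contra h
    rw [Set.not_nonempty_iff_eq_empty] at h
    simp [weakNorm, h] at hv
  obtain ⟨C, -, hC, hmem⟩ := exists_seq_tendsto_sInf hne (OrderBot.bddBelow _)
  have ht' : ENNReal.ofReal t ^ 2 ≠ 0 := by simpa using ht
  exact ge_of_tendsto' (ENNReal.Tendsto.div_const (ENNReal.Tendsto.pow hC) (Or.inr ht'))
    fun n => hmem n t ht

theorem norm_kernel (x : Plane) : ‖kernel x‖ = 1 / (2 * Real.pi * ‖x‖) := by
  rw [kernel, norm_smul, Real.norm_of_nonneg (by positivity)]
  rcases eq_or_ne x 0 with rfl | hx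
  · simp
  · have := norm_pos_iff.2 hx
    field_simp

theorem measurable_kernel : Measurable kernel := by
  unfold kernel
  fun_prop

theorem weakNorm_kernel_lt_top : weakNorm kernel < ∞ := by
  -- The level set lies in a disc of area `1 / (4 π t²)`, so the crude constant 1 is admissible.
  refine lt_of_le_of_lt (sInf_le (a := (1 : ℝ≥0∞)) fun t ht => ?_) ENNReal.one_lt_top
  have hsub : {x | t < ‖kernel x‖} ⊆ Metric.ball 0 (1 / (2 * Real.pi * t)) := by
    intro x hx
    rw [Set.mem_ofPred_eq, norm_kernel] at hx
    have hx0 : 0 < ‖x‖ := by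
      by_contra h
      have : ‖x‖ = 0 := le_antisymm (not_lt.1 h) (norm_nonneg _)
      rw [this] at hx
      simp at hx
      linarith
    rw [mem_ball_zero_iff]
    rw [lt_div_iff₀ (by positivity)] at hx ⊢
    linarith
  refine (measure_mono hsub).trans ?_
  rw [EuclideanSpace.volume_ball_fin_two, one_pow, ← ENNReal.ofReal_pow (by positivity),
    ← ENNReal.ofReal_pow ht.le, ← ENNReal.ofReal_mul (by positivity), ← ENNReal.ofReal_one,
    ← ENNReal.ofReal_div_of_pos (by positivity)]
  refine ENNReal.ofReal_le_ofReal ?_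
  have hpi := Real.pi_gt_three
  rw [div_pow, one_pow, div_mul_eq_mul_div, one_mul, div_le_div_iff₀ (by positivity) (by positivity)]
  have : 0 < t ^ 2 := by positivity
  nlinarith [mul_pos this Real.pi_pos]

/-- The two bounds cross at `T = W / √M`; each side of `T` contributes at most `W √M`. -/
theorem lintegral_min_le {M W : ℝ≥0∞} (hW : W ≠ ∞) :
    ∫⁻ t in Set.Ioi (0 : ℝ), min M (W ^ 2 / ENNReal.ofReal t ^ 2) ≤ 2 * W * M ^ (1 / 2 : ℝ) := by
  rcases eq_or_ne W 0 with rfl | hW0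
  · simp
  rcases eq_or_ne M 0 with rfl | hM0
  · simp
  rcases eq_or_ne M ∞ with rfl | hM
  · rw [ENNReal.top_rpow_of_pos (by norm_num), ENNReal.mul_top (by simp [hW0])]
    exact le_top
  obtain ⟨w, rfl⟩ : ∃ w : ℝ, W = ENNReal.ofReal w := ⟨W.toReal, (ENNReal.ofReal_toReal hW).symm⟩
  obtain ⟨m, rfl⟩ : ∃ m : ℝ, M = ENNReal.ofReal m := ⟨M.toReal, (ENNReal.ofReal_toReal hM).symm⟩
  have hw : 0 < w := by simpa using hW0
  have hm : 0 < m := by simpa using hM0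
  set T := w / √m with hT
  have hs : 0 < √m := Real.sqrt_pos.2 hm
  have hss : √m * √m = m := Real.mul_self_sqrt hm.le
  have hTpos : 0 < T := div_pos hw hs
  have h1 : ∫⁻ t in Set.Ioc 0 T, min (ENNReal.ofReal m) (ENNReal.ofReal w ^ 2 / ENNReal.ofReal t ^ 2)
      ≤ ENNReal.ofReal (w * √m) := by
    refine (lintegral_mono fun t => min_le_left _ _).trans ?_
    rw [lintegral_const, Measure.restrict_apply_univ, Real.volume_Ioc, sub_zero,
      ← ENNReal.ofReal_mul hm.le]
    refine ENNReal.ofReal_le_ofReal (le_of_eq ?_)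
    rw [hT]
    field_simp
    nlinarith
  have h2 : ∫⁻ t in Set.Ioi T, min (ENNReal.ofReal m) (ENNReal.ofReal w ^ 2 / ENNReal.ofReal t ^ 2)
      ≤ ENNReal.ofReal (w * √m) := by
    have hint := (integrableOn_Ioi_rpow_of_lt (by norm_num : (-2 : ℝ) < -1) hTpos).const_mul (w ^ 2)
    have e : ∫⁻ t in Set.Ioi T, min (ENNReal.ofReal m) (ENNReal.ofReal w ^ 2 / ENNReal.ofReal t ^ 2)
        ≤ ∫⁻ t in Set.Ioi T, ENNReal.ofReal (w ^ 2 * t ^ (-2 : ℝ)) := by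
      refine setLIntegral_mono' measurableSet_Ioi fun t ht => (min_le_right _ _).trans (le_of_eq ?_)
      have ht0 : 0 < t := hTpos.trans ht
      rw [← ENNReal.ofReal_pow hw.le, ← ENNReal.ofReal_pow ht0.le,
        ← ENNReal.ofReal_div_of_pos (by positivity), Real.rpow_neg ht0.le, div_eq_mul_inv]
      norm_num
    refine e.trans ?_
    rw [← ofReal_integral_eq_lintegral_ofReal hint, integral_const_mul,
      integral_Ioi_rpow_of_lt (by norm_num) hTpos]
    · refine ENNReal.ofReal_le_ofReal (le_of_eq ?_)
      norm_num
      rw [Real.rpow_neg_one, hT]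
      field_simp
    · refine (ae_restrict_iff' measurableSet_Ioi).2 (Eventually.of_forall fun t ht => ?_)
      have ht0 : 0 < t := hTpos.trans ht
      show (0 : ℝ) ≤ w ^ 2 * t ^ (-2 : ℝ)
      positivity
  rw [← Set.Ioc_union_Ioi_eq_Ioi hTpos.le]
  refine (lintegral_union_le _ _ _).trans ((add_le_add h1 h2).trans (le_of_eq ?_))
  rw [ENNReal.ofReal_rpow_of_pos hm, ← Real.sqrt_eq_rpow, mul_assoc, ← ENNReal.ofReal_mul hw.le,
    two_mul]

/-- Two layer cakes. The one for `‖v‖` bounds its mass on any set `E` by `2 W |E|^{1/2}`; the one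
for `|r|`, taken with respect to the measure `‖v‖ dx`, then yields the Lorentz norm. The factor 2 is
the one in `lorentzNorm`, so the final constant is exactly `W`. -/
theorem lintegral_mul_le_lorentzNorm {r : Plane → ℝ} {v : Plane → Plane} {W : ℝ≥0∞}
    (hr : AEMeasurable r) (hv : AEMeasurable v) (hW : W ≠ ∞)
    (h : ∀ t : ℝ, 0 < t → volume {x | t < ‖v x‖} ≤ W ^ 2 / ENNReal.ofReal t ^ 2) :
    ∫⁻ x, ‖r x‖ₑ * ‖v x‖ₑ ≤ W * lorentzNorm r := by
  have hset : ∀ E : Set Plane, ∫⁻ x in E, ‖v x‖ₑ ≤ 2 * W * volume E ^ (1 / 2 : ℝ) := by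
    intro E
    simp only [← ofReal_norm]
    rw [lintegral_eq_lintegral_meas_lt _ (Eventually.of_forall fun x => norm_nonneg _)
      hv.norm.restrict]
    refine le_trans ?_ (lintegral_min_le hW)
    refine setLIntegral_mono' measurableSet_Ioi fun t ht => le_min ?_ ?_
    · exact (measure_mono (Set.subset_univ _)).trans (by simp)
    · exact (Measure.restrict_apply_le _ _).trans (h t ht)
  have e : ∫⁻ x, ‖r x‖ₑ * ‖v x‖ₑ = ∫⁻ x, ENNReal.ofReal |r x| ∂volume.withDensity
      (fun x => ‖v x‖ₑ) := by
    rw [lintegral_withDensity_eq_lintegral_mul₀ hv.enorm]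
    · refine lintegral_congr fun x => ?_
      simp only [Pi.mul_apply, ← Real.norm_eq_abs, ofReal_norm]
      rw [mul_comm]
    · exact hr.norm.ennreal_ofReal
  rw [e, lintegral_eq_lintegral_meas_lt _ (Eventually.of_forall fun x => abs_nonneg _)
    ((hr.norm).mono_ac (withDensity_absolutelyContinuous _ _)), lorentzNorm, ← mul_assoc,
    mul_comm W 2, ← lintegral_const_mul' _ _ (ENNReal.mul_ne_top (by norm_num) hW)]
  refine lintegral_mono fun s => ?_
  rw [withDensity_apply' _ _]
  exact hset _

theorem lintegral_mul_kernel_le {r : Plane → ℝ} (hr : AEMeasurable r) (x : Plane) :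
    ∫⁻ y, ‖r y‖ₑ * ‖kernel (x - y)‖ₑ ≤ weakNorm kernel * lorentzNorm r := by
  refine lintegral_mul_le_lorentzNorm hr (by have := measurable_kernel; fun_prop)
    weakNorm_kernel_lt_top.ne fun t ht => ?_
  refine le_trans (le_of_eq ?_) (measure_lt_le_weakNorm weakNorm_kernel_lt_top ht)
  -- The reflected translation `y ↦ x - y` preserves area, hence the distribution function of the
  -- kernel.
  exact (Measure.measurePreserving_sub_left volume x).measure_preimage
    (measurableSet_lt measurable_const measurable_kernel.norm).nullMeasurableSet

theorem integrable_smul_kernel {r : Plane → ℝ} (hr : AEStronglyMeasurable r)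
    (h : lorentzNorm r < ∞) (x : Plane) : Integrable (fun y => r y • kernel (x - y)) := by
  refine ⟨hr.smul ?_, ?_⟩
  · exact (measurable_kernel.comp (measurable_const.sub measurable_id)).aestronglyMeasurable
  · rw [hasFiniteIntegral_iff_enorm]
    simp only [enorm_smul]
    exact (lintegral_mul_kernel_le hr.aemeasurable x).trans_lt
      (ENNReal.mul_lt_top weakNorm_kernel_lt_top h)

theorem enorm_helmholtz_le {r : Plane → ℝ} (hr : AEStronglyMeasurable r) (x : Plane) :
    ‖helmholtz r x‖ₑ ≤ weakNorm kernel * lorentzNorm r := by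
  refine (enorm_integral_le_lintegral_enorm _).trans ?_
  simp only [enorm_smul]
  exact lintegral_mul_kernel_le hr.aemeasurable x

theorem aestronglyMeasurable_smul_kernel {r : Plane → ℝ} (hr : AEStronglyMeasurable r) :
    AEStronglyMeasurable (fun p : Plane × Plane => r p.2 • kernel (p.1 - p.2))
      (volume.prod volume) :=
  hr.comp_snd.smul
    (measurable_kernel.comp (measurable_fst.sub measurable_snd)).aestronglyMeasurable

theorem aestronglyMeasurable_helmholtz {r : Plane → ℝ} (hr : AEStronglyMeasurable r) :
    AEStronglyMeasurable (helmholtz r) :=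
  (aestronglyMeasurable_smul_kernel hr).integral_prod_right'

theorem eLpNorm_helmholtz_le {r : Plane → ℝ} (hr : AEStronglyMeasurable r) :
    eLpNorm (helmholtz r) ∞ volume ≤ weakNorm kernel * lorentzNorm r := by
  rw [eLpNorm_exponent_top]
  exact eLpNormEssSup_le_of_ae_enorm_bound (Eventually.of_forall (enorm_helmholtz_le hr))

end LorentzHolder

/-! ### The kernel inverts the divergence -/

section FundamentalSolution

/-- Polar coordinates; the weight is `s` raised to the dimension minus one. -/
theorem integral_eq_integral_toSphere {F : Plane → ℝ} (hF : Integrable F) :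
    ∫ x, F x = ∫ n : Metric.sphere (0 : Plane) 1,
      (∫ s in Set.Ioi (0 : ℝ), s * F (s • (n : Plane))) ∂(volume : Measure Plane).toSphere := by
  have hmp := (volume : Measure Plane).measurePreserving_homeomorphUnitSphereProd
  have hemb := (homeomorphUnitSphereProd Plane).measurableEmbedding
  have hfin : Module.finrank ℝ Plane - 1 = 1 := by simp
  have hsub : MeasurableSet ({0}ᶜ : Set Plane) := (measurableSet_singleton 0).compl
  set G : Metric.sphere (0 : Plane) 1 × Set.Ioi (0 : ℝ) → ℝ := fun p => F (p.2.1 • p.1.1)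
  have hG : ∀ x : ({0}ᶜ : Set Plane), G (homeomorphUnitSphereProd Plane x) = F x := by
    intro x
    have := homeomorphUnitSphereProd_symm_apply_coe Plane (homeomorphUnitSphereProd Plane x)
    rw [Homeomorph.symm_apply_apply] at this
    simp only [G, ← this]
  have hint : Integrable G ((volume : Measure Plane).toSphere.prod
      (Measure.volumeIoiPow (Module.finrank ℝ Plane - 1))) := by
    rw [← hmp.integrable_comp_emb hemb]
    refine Integrable.congr (f := fun x : ({0}ᶜ : Set Plane) => F x) ?_
      (Eventually.of_forall fun x => (hG x).symm)
    exact (integrableOn_iff_comap_subtypeVal hsub).1 hF.integrableOn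
  calc ∫ x, F x = ∫ x in ({0}ᶜ : Set Plane), F x := by rw [restrict_compl_singleton]
    _ = ∫ x : ({0}ᶜ : Set Plane), F x ∂(volume.comap Subtype.val) :=
      (integral_subtype_comap hsub F).symm
    _ = ∫ p, G p ∂((volume : Measure Plane).toSphere.prod
          (Measure.volumeIoiPow (Module.finrank ℝ Plane - 1))) := by
      rw [← hmp.integral_comp hemb]
      exact integral_congr_ae (Eventually.of_forall fun x => (hG x).symm)
    _ = ∫ n, ∫ s, G (n, s) ∂(Measure.volumeIoiPow (Module.finrank ℝ Plane - 1))
          ∂(volume : Measure Plane).toSphere := integral_prod _ hint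
    _ = _ := by
      refine integral_congr_ae (Eventually.of_forall fun n => ?_)
      simp only [Measure.volumeIoiPow, ENNReal.ofReal, G]
      rw [integral_withDensity_eq_integral_smul, hfin,
        integral_subtype_comap measurableSet_Ioi
          fun a : ℝ => Real.toNNReal (a ^ 1) • F (a • (n : Plane))]
      · refine setIntegral_congr_fun measurableSet_Ioi fun s hs => ?_
        simp only [NNReal.smul_def, pow_one, Real.coe_toNNReal _ (le_of_lt hs),
          smul_eq_mul]
      · exact (measurable_subtype_coe.pow_const _).real_toNNReal

/-- Applied to `‖∇φ‖`, this makes the pairing of `∇φ` with the singular kernel integrable through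
the same duality. -/
theorem lorentzNorm_lt_top_of_hasCompactSupport {g : Plane → ℝ} (hg : Continuous g)
    (hc : HasCompactSupport g) : lorentzNorm g < ∞ := by
  obtain ⟨C, hC⟩ := hc.exists_bound_of_continuous hg
  have hvol : volume (tsupport g) < ∞ := hc.isCompact.measure_lt_top
  refine ENNReal.mul_lt_top (by norm_num) ?_
  calc ∫⁻ t in Set.Ioi (0 : ℝ), volume {x | t < |g x|} ^ (1 / 2 : ℝ)
      ≤ ∫⁻ t in Set.Ioi (0 : ℝ), (Set.Iio C).indicator
          (fun _ => volume (tsupport g) ^ (1 / 2 : ℝ)) t := by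
        refine setLIntegral_mono' measurableSet_Ioi fun t ht => ?_
        by_cases htC : t < C
        · rw [Set.indicator_of_mem (show t ∈ Set.Iio C from htC)]
          gcongr
          intro x hx
          apply subset_tsupport
          intro h0
          have hx' : t < |g x| := hx
          rw [h0, abs_zero] at hx'
          exact lt_asymm ht hx'
        · have : {x | t < |g x|} = ∅ := by
            ext x
            simpa using (hC x).trans (not_lt.1 htC)
          simp [this]
    _ = volume (tsupport g) ^ (1 / 2 : ℝ) * volume (Set.Iio C ∩ Set.Ioi 0) := by
        rw [lintegral_indicator measurableSet_Iio, Measure.restrict_restrict measurableSet_Iio,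
          setLIntegral_const]
    _ < ∞ := by
        refine ENNReal.mul_lt_top (ENNReal.rpow_lt_top_of_nonneg (by norm_num) hvol.ne) ?_
        rw [Set.inter_comm, Set.Ioi_inter_Iio]
        simp

variable {φ : Plane → ℝ}

theorem integrable_fderiv_kernel (hφ : ContDiff ℝ 1 φ) (hc : HasCompactSupport φ) (y : Plane) :
    Integrable (fun x => fderiv ℝ φ x (kernel (x - y))) := by
  have hcont : Continuous (fderiv ℝ φ) := hφ.continuous_fderiv (by simp)
  have h := integrable_smul_kernel (r := fun x => ‖fderiv ℝ φ x‖)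
    hcont.norm.aestronglyMeasurable
    (lorentzNorm_lt_top_of_hasCompactSupport hcont.norm (hc.fderiv ℝ).norm) y
  refine h.norm.mono' ?_ (Eventually.of_forall fun x => ?_)
  · exact (ContinuousLinearMap.id ℝ (Plane →L[ℝ] ℝ)).aestronglyMeasurable_comp₂
      hcont.aestronglyMeasurable
      (measurable_kernel.comp (measurable_id.sub measurable_const)).aestronglyMeasurable
  · rw [norm_smul, norm_norm, norm_kernel, norm_sub_rev, ← norm_kernel]
    exact (fderiv ℝ φ x).le_opNorm _

/-- In polar coordinates about `y` the Jacobian `s` cancels the size `1 / (2 π s)` of the kernel,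
leaving the radial derivative of `φ`. Each ray contributes `-φ y / (2 π)`, and the unit circle has
length `2 π`. -/
theorem integral_fderiv_kernel (hφ : ContDiff ℝ 1 φ) (hc : HasCompactSupport φ) (y : Plane) :
    ∫ x, fderiv ℝ φ x (kernel (x - y)) = - φ y := by
  have hint := (integrable_fderiv_kernel hφ hc y).comp_add_right y
  have hd : Differentiable ℝ φ := hφ.differentiable (by simp)
  rw [← integral_add_right_eq_self _ y, integral_eq_integral_toSphere hint]
  have hin : ∀ n : Metric.sphere (0 : Plane) 1,
      ∫ s in Set.Ioi (0 : ℝ), s * fderiv ℝ φ (s • (n : Plane) + y) (kernel (s • (n : Plane) + y - y))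
        = (1 / (2 * Real.pi)) * (- φ y) := by
    intro n
    have hn : ‖(n : Plane)‖ = 1 := by simp
    set g : ℝ → ℝ := fun s => φ (s • (n : Plane) + y)
    have hg : ContDiff ℝ 1 g := hφ.comp (by fun_prop)
    have hgd : ∀ s, deriv g s = fderiv ℝ φ (s • (n : Plane) + y) n := by
      intro s
      have h1 : HasDerivAt (fun s : ℝ => s • (n : Plane) + y) (n : Plane) s := by
        simpa using ((hasDerivAt_id s).smul_const (n : Plane)).add_const y
      exact ((hd _).hasFDerivAt.comp_hasDerivAt s h1).deriv
    have hgc : HasCompactSupport g := by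
      obtain ⟨R, hR⟩ := hc.isCompact.isBounded.subset_closedBall 0
      refine HasCompactSupport.intro (isCompact_Icc (a := -(R + ‖y‖)) (b := R + ‖y‖))
        fun s hs => ?_
      by_contra h
      have h1 := hR (subset_tsupport φ h)
      rw [mem_closedBall_zero_iff] at h1
      have h2 : ‖s • (n : Plane)‖ ≤ R + ‖y‖ := by
        have := norm_sub_le (s • (n : Plane) + y) y
        rw [add_sub_cancel_right] at this
        linarith
      rw [norm_smul, hn, mul_one, Real.norm_eq_abs, abs_le] at h2
      exact hs h2
    have h0 : - φ y = ∫ s in Set.Ioi (0 : ℝ), deriv g s := by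
      rw [hgc.integral_Ioi_deriv_eq hg]
      simp [g]
    rw [h0, ← integral_const_mul]
    refine setIntegral_congr_fun measurableSet_Ioi fun s hs => ?_
    have hs0 : (0 : ℝ) < s := hs
    simp only [add_sub_cancel_right, hgd, kernel, map_smul, norm_smul, hn, smul_eq_mul, mul_one,
      Real.norm_of_nonneg hs0.le]
    field_simp
  rw [integral_congr_ae (Eventually.of_forall hin), integral_const, Measure.toSphere_real_apply_univ]
  simp [Measure.real, EuclideanSpace.volume_ball_fin_two, Real.pi_pos.le]
  field_simp

/-- Fubini reduces the identity to the kernel. Absolute integrability of the double integral follows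
from the bound on `∫ |r y| ‖ψ (x - y)‖ dy`, uniform in `x`, and the integrability of `∇φ`. -/
theorem isWeakDiv_helmholtz {r : Plane → ℝ} (hr : LocallyIntegrable r)
    (hr' : lorentzNorm r < ∞) : IsWeakDiv Set.univ (helmholtz r) r := by
  have hm : AEStronglyMeasurable r := hr.aestronglyMeasurable
  have hW : weakNorm kernel * lorentzNorm r < ∞ := ENNReal.mul_lt_top weakNorm_kernel_lt_top hr'
  have hmem : MemLp (helmholtz r) ∞ :=
    ⟨aestronglyMeasurable_helmholtz hm, (eLpNorm_helmholtz_le hm).trans_lt hW⟩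
  refine ⟨(hmem.locallyIntegrable le_top).locallyIntegrableOn _, hr.locallyIntegrableOn _,
    fun φ hφ => ?_⟩
  have hφ1 : ContDiff ℝ 1 φ := hφ.1.of_le (by exact_mod_cast le_top)
  have hcont := hφ.continuous_fderiv
  rw [setIntegral_univ, setIntegral_univ]
  have h1 : ∀ x, fderiv ℝ φ x (helmholtz r x) =
      ∫ y, fderiv ℝ φ x (r y • kernel (x - y)) := fun x =>
    ((fderiv ℝ φ x).integral_comp_comm (integrable_smul_kernel hm hr' x)).symm
  have hprod : Integrable (fun p : Plane × Plane => fderiv ℝ φ p.1 (r p.2 • kernel (p.1 - p.2)))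
      (volume.prod volume) := by
    refine ⟨(ContinuousLinearMap.id ℝ (Plane →L[ℝ] ℝ)).aestronglyMeasurable_comp₂
      (hcont.comp continuous_fst).aestronglyMeasurable (aestronglyMeasurable_smul_kernel hm), ?_⟩
    rw [hasFiniteIntegral_iff_enorm]
    have hI : Integrable (fderiv ℝ φ) := hcont.integrable_of_hasCompactSupport (hφ.2.1.fderiv ℝ)
    have hb : ∫⁻ p : Plane × Plane, ‖fderiv ℝ φ p.1‖ₑ * ‖r p.2 • kernel (p.1 - p.2)‖ₑ
        ∂(volume.prod volume) ≤ (∫⁻ x, ‖fderiv ℝ φ x‖ₑ) * (weakNorm kernel * lorentzNorm r) := by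
      rw [lintegral_prod, ← lintegral_mul_const' _ _ hW.ne]
      · refine lintegral_mono fun x => ?_
        simp only
        rw [lintegral_const_mul' _ _ enorm_ne_top]
        gcongr
        simp only [enorm_smul]
        exact lintegral_mul_kernel_le hm.aemeasurable x
      · exact ((hcont.comp continuous_fst).aestronglyMeasurable.enorm).mul
          (aestronglyMeasurable_smul_kernel hm).enorm
    refine lt_of_le_of_lt (lintegral_mono fun p => (fderiv ℝ φ p.1).le_opENorm _) ?_
    exact hb.trans_lt (ENNReal.mul_lt_top hI.2 hW)
  simp only [h1]
  rw [integral_integral_swap hprod, ← integral_neg]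
  refine integral_congr_ae (Eventually.of_forall fun y => ?_)
  simp only [map_smul, smul_eq_mul]
  rw [integral_const_mul, integral_fderiv_kernel hφ1 hφ.2.1]
  ring

end FundamentalSolution

/-! ### The embedding into `L^{2,1}` for smooth functions -/

section SmoothEmbedding

/-- Dilations `b (x / (n + 1))` of one bump; the chain rule makes the gradients uniformly small. -/
theorem exists_cutoff : ∃ (χ : ℕ → Plane → ℝ) (C : ℝ≥0), (∀ n, ContDiff ℝ (⊤ : ℕ∞) (χ n)) ∧
    (∀ n, HasCompactSupport (χ n)) ∧ (∀ n x, 0 ≤ χ n x ∧ χ n x ≤ 1) ∧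
    (∀ n x, ‖fderiv ℝ (χ n) x‖ ≤ C * (1 / ((n : ℝ) + 1))) ∧
    ∀ x, Tendsto (fun n => χ n x) atTop (𝓝 1) := by
  let b : ContDiffBump (0 : Plane) := ⟨1, 2, one_pos, one_lt_two⟩
  have hb : ContDiff ℝ (⊤ : ℕ∞) b := b.contDiff
  have hbd : Differentiable ℝ b := hb.differentiable (by simp)
  obtain ⟨C, hC⟩ := (b.hasCompactSupport.fderiv ℝ).exists_bound_of_continuous
    (hb.continuous_fderiv (by simp))
  have hC0 : 0 ≤ C := (norm_nonneg _).trans (hC 0)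
  set a : ℕ → ℝ := fun n => 1 / ((n : ℝ) + 1)
  have ha : ∀ n, 0 < a n := fun n => Nat.one_div_pos_of_nat
  refine ⟨fun n x => b (a n • x), ⟨C, hC0⟩, fun n => hb.comp (by fun_prop), fun n => ?_,
    fun n x => ⟨b.nonneg, b.le_one⟩, fun n x => ?_, fun x => ?_⟩
  · exact b.hasCompactSupport.comp_homeomorph (Homeomorph.smulOfNeZero (a n) (ha n).ne')
  · have h1 : HasFDerivAt (fun x : Plane => b (a n • x))
        ((fderiv ℝ b (a n • x)).comp (a n • ContinuousLinearMap.id ℝ Plane)) x :=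
      (hbd _).hasFDerivAt.comp x ((hasFDerivAt_id x).const_smul (a n))
    rw [h1.fderiv, ContinuousLinearMap.comp_smul, ContinuousLinearMap.comp_id, norm_smul,
      Real.norm_of_nonneg (ha n).le, mul_comm]
    exact mul_le_mul_of_nonneg_right (hC _) (ha n).le
  · have h1 : Tendsto (fun n => a n • x) atTop (𝓝 0) := by
      simpa only [zero_smul] using
        (tendsto_one_div_add_atTop_nhds_zero_nat (𝕜 := ℝ)).smul_const x
    have h2 := (hb.continuous.tendsto 0).comp h1
    rwa [b.one_of_mem_closedBall (by simp [b])] at h2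

/-- The constant of the Gagliardo–Nirenberg–Sobolev inequality in the plane. -/
noncomputable def gnsConst : ℝ≥0 :=
  eLpNormLESNormFDerivOneConst (volume : Measure Plane) ((2 : ℝ≥0) : ℝ)

theorem eLpNorm_two_le_of_hasCompactSupport {h : Plane → ℝ} (hh : ContDiff ℝ 1 h)
    (hc : HasCompactSupport h) : eLpNorm h 2 volume ≤ gnsConst * ∫⁻ x, ‖fderiv ℝ h x‖ₑ := by
  have hp : (Nat.cast (Module.finrank ℝ Plane) : ℝ≥0).HolderConjugate 2 := by
    simp only [finrank_euclideanSpace, Fintype.card_fin, Nat.cast_ofNat]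
    exact NNReal.HolderConjugate.two_two
  have := eLpNorm_le_eLpNorm_fderiv_one (volume : Measure Plane) hh hc hp
  rwa [eLpNorm_one_eq_lintegral_enorm] at this

/-- Cutoffs remove the compact support: the gradient falling on the cutoff costs at most `C / (n +
1)` times `∫ |h|`, and Fatou's lemma handles the left side. -/
theorem eLpNorm_two_le {h : Plane → ℝ} (hh : ContDiff ℝ 1 h) (hfin : ∫⁻ x, ‖h x‖ₑ < ∞) :
    eLpNorm h 2 volume ≤ gnsConst * ∫⁻ x, ‖fderiv ℝ h x‖ₑ := by
  obtain ⟨χ, C, hχ, hχc, hχb, hχd, hχl⟩ := exists_cutoff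
  have hχ1 : ∀ n, ContDiff ℝ 1 (χ n) := fun n => (hχ n).of_le (by exact_mod_cast le_top)
  have hcd : ∀ n, ContDiff ℝ 1 (fun x => χ n x * h x) := fun n => (hχ1 n).mul hh
  have hlim := Lp.eLpNorm_lim_le_liminf_eLpNorm (μ := (volume : Measure Plane)) (p := 2)
    (f := fun n x => χ n x * h x) (fun n => (hcd n).continuous.aestronglyMeasurable) h
    (Eventually.of_forall fun x => by simpa using (hχl x).mul_const (h x))
  set A := ∫⁻ x, ‖fderiv ℝ h x‖ₑ
  set B := ∫⁻ x, ‖h x‖ₑ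
  have hbound : ∀ n : ℕ, eLpNorm (fun x => χ n x * h x) 2 volume ≤
      gnsConst * (A + ENNReal.ofReal (C * (1 / ((n : ℝ) + 1))) * B) := by
    intro n
    refine (eLpNorm_two_le_of_hasCompactSupport (hcd n) ((hχc n).mul_right)).trans ?_
    gcongr
    rw [← lintegral_const_mul' _ _ ENNReal.ofReal_ne_top,
      ← lintegral_add_left (hh.continuous_fderiv (by simp)).enorm.measurable]
    refine lintegral_mono fun x => ?_
    simp only
    rw [fderiv_fun_mul ((hχ1 n).differentiable (by simp) x) (hh.differentiable (by simp) x)]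
    refine (enorm_add_le (χ n x • fderiv ℝ h x) (h x • fderiv ℝ (χ n) x)).trans ?_
    rw [enorm_smul, enorm_smul, mul_comm (ENNReal.ofReal _)]
    gcongr
    · refine mul_le_of_le_one_left' ?_
      rw [Real.enorm_eq_ofReal (hχb n x).1]
      exact ENNReal.ofReal_le_one.2 (hχb n x).2
    · rw [← ofReal_norm]
      exact ENNReal.ofReal_le_ofReal (hχd n x)
  have hT : Tendsto (fun n : ℕ => (gnsConst : ℝ≥0∞) *
      (A + ENNReal.ofReal (C * (1 / ((n : ℝ) + 1))) * B)) atTop (𝓝 (gnsConst * A)) := by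
    have h0 : Tendsto (fun n : ℕ => ENNReal.ofReal (C * (1 / ((n : ℝ) + 1)))) atTop (𝓝 0) := by
      have := ENNReal.tendsto_ofReal
        ((tendsto_one_div_add_atTop_nhds_zero_nat (𝕜 := ℝ)).const_mul (C : ℝ))
      simpa only [mul_zero, ENNReal.ofReal_zero] using this
    have h1 := ENNReal.Tendsto.mul_const h0 (b := B) (Or.inr hfin.ne)
    rw [zero_mul] at h1
    have h2 := ENNReal.Tendsto.const_mul (tendsto_const_nhds (x := A) |>.add h1)
      (a := (gnsConst : ℝ≥0∞)) (Or.inr ENNReal.coe_ne_top)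
    simpa only [add_zero] using h2
  exact hlim.trans ((liminf_le_liminf (Eventually.of_forall hbound)).trans hT.liminf_eq.le)

/-- A smooth truncation of the absolute value: `0` for `|s| ≤ 1` and `1` for `|s| ≥ 2`. -/
noncomputable def truncation (s : ℝ) : ℝ := Real.smoothTransition ((s ^ 2 - 1) / 3)

theorem contDiff_truncation : ContDiff ℝ 1 truncation := by
  have : ContDiff ℝ 1 Real.smoothTransition :=
    Real.smoothTransition.contDiff (n := 1)
  exact this.comp (by fun_prop)

theorem truncation_eq_zero {s : ℝ} (h : |s| ≤ 1) : truncation s = 0 := by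
  apply Real.smoothTransition.zero_of_nonpos
  have : s ^ 2 ≤ 1 := by rw [← sq_abs]; nlinarith [abs_nonneg s]
  linarith

theorem truncation_eq_one {s : ℝ} (h : 2 ≤ |s|) : truncation s = 1 := by
  apply Real.smoothTransition.one_of_one_le
  have : 4 ≤ s ^ 2 := by rw [← sq_abs]; nlinarith
  linarith

theorem deriv_truncation_eq_zero {s : ℝ} (h : |s| < 1 ∨ 2 < |s|) : deriv truncation s = 0 := by
  rcases h with h | h
  · have : truncation =ᶠ[𝓝 s] fun _ => 0 := by
      filter_upwards [continuous_abs.continuousAt.eventually (gt_mem_nhds h)] with t ht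
      exact truncation_eq_zero ht.le
    rw [this.deriv_eq, deriv_const]
  · have : truncation =ᶠ[𝓝 s] fun _ => 1 := by
      filter_upwards [continuous_abs.continuousAt.eventually (lt_mem_nhds h)] with t ht
      exact truncation_eq_one ht.le
    rw [this.deriv_eq, deriv_const]

theorem exists_bound_deriv_truncation : ∃ C : ℝ≥0, ∀ s, ‖deriv truncation s‖ ≤ C := by
  have hc : HasCompactSupport (deriv truncation) := by
    refine HasCompactSupport.intro (isCompact_Icc (a := -2) (b := 2)) fun s hs => ?_
    refine deriv_truncation_eq_zero (Or.inr ?_)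
    by_contra h
    exact hs (abs_le.1 (not_lt.1 h))
  obtain ⟨C, hC⟩ := hc.exists_bound_of_continuous (contDiff_truncation.continuous_deriv le_rfl)
  exact ⟨⟨C, (norm_nonneg _).trans (hC 0)⟩, hC⟩

/-- The truncation `h` of `g` at height `s` is 1 where `|g| > s` and 0 where `|g| ≤ s / 2`, and its
gradient, at most `(2 C / s) ‖∇g‖`, lives on the band in between. The Sobolev inequality for `h`
gives the bound. -/
theorem rpow_measure_lt_le {g : Plane → ℝ} (hg : ContDiff ℝ 1 g)
    (hfin : ∀ t : ℝ, 0 < t → volume {x | t < |g x|} < ∞) {C : ℝ≥0}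
    (hC : ∀ s, ‖deriv truncation s‖ ≤ C) {s : ℝ} (hs : 0 < s) :
    volume {x | s < |g x|} ^ (1 / 2 : ℝ) ≤ gnsConst * C * ∫⁻ x,
      {p : ℝ × Plane | |g p.2| ≤ p.1 ∧ p.1 ≤ 2 * |g p.2|}.indicator
        (fun p => ENNReal.ofReal (2 / p.1) * ‖fderiv ℝ g p.2‖ₑ) (s, x) := by
  set h : Plane → ℝ := fun x => truncation ((2 / s) * g x)
  have hs2 : 0 < 2 / s := by positivity
  have habs : ∀ x, |2 / s * g x| = 2 / s * |g x| := fun x => by rw [abs_mul, abs_of_pos hs2]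
  have hh : ContDiff ℝ 1 h := contDiff_truncation.comp (contDiff_const.mul hg)
  have hsupp : ∀ x, |g x| ≤ s / 2 → h x = 0 := fun x hx => truncation_eq_zero (by
    rw [habs, div_mul_eq_mul_div, div_le_one hs]; linarith)
  have hone : ∀ x, s < |g x| → h x = 1 := fun x hx => truncation_eq_one (by
    rw [habs, div_mul_eq_mul_div, le_div_iff₀ hs]; linarith)
  have hm : MeasurableSet {x | s < |g x|} :=
    measurableSet_lt measurable_const hg.continuous.abs.measurable
  have hm2 : MeasurableSet {x | s / 2 < |g x|} :=
    measurableSet_lt measurable_const hg.continuous.abs.measurable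
  -- Here finiteness of the level sets enters: `h` is bounded by 1 and vanishes off `{|g| > s / 2}`.
  have hh1 : ∫⁻ x, ‖h x‖ₑ < ∞ := by
    refine lt_of_le_of_lt (lintegral_mono (g := {x | s / 2 < |g x|}.indicator 1) fun x => ?_) ?_
    · by_cases hx : s / 2 < |g x|
      · rw [Set.indicator_of_mem (by exact hx), Pi.one_apply,
          show h x = Real.smoothTransition _ from rfl, Real.enorm_eq_ofReal (Real.smoothTransition.nonneg _)]
        exact ENNReal.ofReal_le_one.2 (Real.smoothTransition.le_one _)
      · simp [hsupp x (not_lt.1 hx)]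
    · rw [lintegral_indicator_one hm2]
      exact hfin _ (by positivity)
  calc volume {x | s < |g x|} ^ (1 / 2 : ℝ)
      = eLpNorm ({x | s < |g x|}.indicator fun _ => (1 : ℝ)) 2 volume := by
        rw [eLpNorm_indicator_const hm (by norm_num) (by norm_num)]
        simp
    _ ≤ eLpNorm h 2 volume := by
        refine eLpNorm_mono fun x => ?_
        by_cases hx : s < |g x|
        · rw [Set.indicator_of_mem (by exact hx), hone x hx]
        · rw [Set.indicator_of_notMem (by exact hx), norm_zero]
          exact norm_nonneg _
    _ ≤ gnsConst * ∫⁻ x, ‖fderiv ℝ h x‖ₑ := eLpNorm_two_le hh hh1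
    _ ≤ gnsConst * ∫⁻ x, C * {p : ℝ × Plane | |g p.2| ≤ p.1 ∧ p.1 ≤ 2 * |g p.2|}.indicator
        (fun p => ENNReal.ofReal (2 / p.1) * ‖fderiv ℝ g p.2‖ₑ) (s, x) := by
        gcongr with x
        have hd : HasFDerivAt h (deriv truncation (2 / s * g x) • ((2 / s) • fderiv ℝ g x)) x :=
          ((contDiff_truncation.differentiable (by simp) _).hasDerivAt).comp_hasFDerivAt x
            ((hg.differentiable (by simp) x).hasFDerivAt.const_mul (2 / s))
        rw [hd.fderiv]
        by_cases hx : |g x| ≤ s ∧ s ≤ 2 * |g x|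
        · rw [Set.indicator_of_mem (by exact hx), enorm_smul, enorm_smul,
            Real.enorm_eq_ofReal hs2.le]
          gcongr
          exact_mod_cast hC _
        · rw [deriv_truncation_eq_zero, zero_smul]
          · exact (enorm_zero (E := Plane →L[ℝ] ℝ)).le.trans zero_le
          · rw [habs, div_mul_eq_mul_div, div_lt_one hs, lt_div_iff₀ hs]
            by_contra! hcon
            exact hx ⟨by linarith, hcon.1⟩
    _ = _ := by rw [lintegral_const_mul' _ _ ENNReal.coe_ne_top, mul_assoc]

/-- A dyadic substitute for the coarea formula and the isoperimetric inequality. After Tonelli, the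
point `x` is charged only at heights between `|g x|` and `2 |g x|`, where `2 / s ≤ 2 / |g x|`, so
its total weight is at most 2. -/
theorem exists_lorentzNorm_le : ∃ K : ℝ≥0, ∀ g : Plane → ℝ, ContDiff ℝ 1 g →
    (∀ t : ℝ, 0 < t → volume {x | t < |g x|} < ∞) →
    lorentzNorm g ≤ K * ∫⁻ x, ‖fderiv ℝ g x‖ₑ := by
  obtain ⟨C, hC⟩ := exists_bound_deriv_truncation
  refine ⟨2 * (gnsConst * C) * 2, fun g hg hfin => ?_⟩
  set F : ℝ × Plane → ℝ≥0∞ := {p : ℝ × Plane | |g p.2| ≤ p.1 ∧ p.1 ≤ 2 * |g p.2|}.indicator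
    (fun p => ENNReal.ofReal (2 / p.1) * ‖fderiv ℝ g p.2‖ₑ) with hF
  have hgm : Measurable g := hg.continuous.measurable
  have hFm : Measurable F := by
    have hfm : Measurable (fderiv ℝ g) := (hg.continuous_fderiv (by simp)).measurable
    refine Measurable.indicator ?_ ?_
    · fun_prop
    · have h1 : Measurable fun p : ℝ × Plane => |g p.2| := by fun_prop
      exact (measurableSet_le h1 measurable_fst).inter
        (measurableSet_le measurable_fst (h1.const_mul 2))
  have hinner : ∀ x, ∫⁻ s in Set.Ioi (0 : ℝ), F (s, x) ≤ 2 * ‖fderiv ℝ g x‖ₑ := by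
    intro x
    rcases (abs_nonneg (g x)).eq_or_lt with h0 | h0
    · refine le_of_eq_of_le ?_ zero_le
      rw [setLIntegral_congr_fun (g := fun _ => 0) measurableSet_Ioi, lintegral_zero]
      intro s hs
      refine Set.indicator_of_notMem (fun h => ?_) _
      have h2 : s ≤ 2 * |g x| := h.2
      rw [← h0] at h2
      exact absurd hs (by simpa using h2)
    · calc ∫⁻ s in Set.Ioi (0 : ℝ), F (s, x)
          ≤ ∫⁻ s, (Set.Icc |g x| (2 * |g x|)).indicator
            (fun _ => ENNReal.ofReal (2 / |g x|) * ‖fderiv ℝ g x‖ₑ) s := by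
            refine (setLIntegral_le_lintegral _ _).trans (lintegral_mono fun s => ?_)
            by_cases hs : |g x| ≤ s ∧ s ≤ 2 * |g x|
            · rw [hF, Set.indicator_of_mem (by exact hs), Set.indicator_of_mem (by exact hs)]
              gcongr
              exact hs.1
            · rw [hF, Set.indicator_of_notMem (by exact hs)]
              exact zero_le
        _ = 2 * ‖fderiv ℝ g x‖ₑ := by
            rw [lintegral_indicator_const measurableSet_Icc, Real.volume_Icc, mul_right_comm,
              ← ENNReal.ofReal_mul (by positivity)]
            congr 1
            rw [show 2 / |g x| * (2 * |g x| - |g x|) = 2 by field_simp; ring]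
            simp
  calc lorentzNorm g
      ≤ 2 * ∫⁻ s in Set.Ioi (0 : ℝ), gnsConst * C * ∫⁻ x, F (s, x) := by
        unfold lorentzNorm
        gcongr 2 * ?_
        exact setLIntegral_mono' measurableSet_Ioi fun s hs => rpow_measure_lt_le hg hfin hC hs
    _ = 2 * (gnsConst * C) * ∫⁻ x, ∫⁻ s in Set.Ioi (0 : ℝ), F (s, x) := by
        rw [lintegral_const_mul' _ _ (ENNReal.mul_ne_top ENNReal.coe_ne_top ENNReal.coe_ne_top),
          lintegral_lintegral_swap (f := fun s x => F (s, x)) hFm.aemeasurable]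
        ring
    _ ≤ 2 * (gnsConst * C) * ∫⁻ x, 2 * ‖fderiv ℝ g x‖ₑ := by
        gcongr with x
        exact hinner x
    _ = _ := by
        rw [lintegral_const_mul' _ _ (by norm_num)]
        push_cast
        ring

end SmoothEmbedding

/-! ### From smooth functions to BV -/

section Mollification

open ContinuousLinearMap (lsmul)

theorem lintegral_enorm_le_of_tendsto {F : ℕ → Plane → ℝ} {h : Plane → ℝ} {M : ℝ≥0∞}
    (hF : ∀ n, AEStronglyMeasurable (F n)) (hlim : ∀ x, Tendsto (fun n => F n x) atTop (𝓝 (h x)))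
    (hM : ∀ n, ∫⁻ x, ‖F n x‖ₑ ≤ M) : ∫⁻ x, ‖h x‖ₑ ≤ M := by
  have := Lp.eLpNorm_lim_le_liminf_eLpNorm (μ := (volume : Measure Plane)) (p := 1) hF h
    (Eventually.of_forall hlim)
  simp only [eLpNorm_one_eq_lintegral_enorm] at this
  exact this.trans (liminf_le_of_frequently_le' (Frequently.of_forall hM))

/-- The convolution of `g` with the kernel `ρ`. -/
noncomputable def mollify (ρ g : Plane → ℝ) : Plane → ℝ :=
  convolution ρ g (lsmul ℝ ℝ) volume

/-- An even smooth compactly supported probability density. -/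
structure IsMollifier (ρ : Plane → ℝ) : Prop where
  contDiff : ContDiff ℝ (⊤ : ℕ∞) ρ
  hasCompactSupport : HasCompactSupport ρ
  nonneg : ∀ x, 0 ≤ ρ x
  even : ∀ x, ρ (-x) = ρ x
  integral_eq_one : ∫ x, ρ x = 1

theorem _root_.ContDiffBump.isMollifier (b : ContDiffBump (0 : Plane)) :
    IsMollifier (b.normed volume) :=
  ⟨b.contDiff_normed, b.hasCompactSupport_normed, b.nonneg_normed, b.normed_neg,
    b.integral_normed⟩

variable {ρ g : Plane → ℝ}

theorem IsMollifier.integrable (hρ : IsMollifier ρ) : Integrable ρ :=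
  hρ.contDiff.continuous.integrable_of_hasCompactSupport hρ.hasCompactSupport

theorem mollify_eq (x : Plane) : mollify ρ g x = ∫ y, ρ (x - y) * g y :=
  convolution_eq_swap _

theorem IsMollifier.integrable_mul (hρ : IsMollifier ρ) (hg : LocallyIntegrable g) (x : Plane) :
    Integrable (fun y => ρ (x - y) * g y) := by
  have h := hg.integrable_smul_left_of_hasCompactSupport (g := fun y => ρ (x - y))
    (hρ.contDiff.continuous.comp (continuous_const.sub continuous_id))
    (hρ.hasCompactSupport.comp_homeomorph (Homeomorph.subLeft x))
  simpa using h

theorem contDiff_mollify (hρ : IsMollifier ρ) (hg : LocallyIntegrable g) :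
    ContDiff ℝ (⊤ : ℕ∞) (mollify ρ g) :=
  hρ.hasCompactSupport.contDiff_convolution_left (n := ⊤) _ hρ.contDiff hg

/-- Fubini, with evenness of `ρ` making mollification self-adjoint. Only the values of `g` on a ball
of radius `R₁ + R₂` matter, so local integrability is enough. -/
theorem integral_mollify_mul (hρ : IsMollifier ρ) (hg : LocallyIntegrable g) {k : Plane → ℝ}
    (hk : Continuous k) (hkc : HasCompactSupport k) :
    ∫ x, mollify ρ g x * k x = ∫ y, g y * mollify ρ k y := by
  obtain ⟨R₁, hR₁⟩ := hρ.hasCompactSupport.isCompact.isBounded.subset_closedBall 0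
  obtain ⟨R₂, hR₂⟩ := hkc.isCompact.isBounded.subset_closedBall 0
  obtain ⟨C, hC⟩ := hρ.hasCompactSupport.exists_bound_of_continuous hρ.contDiff.continuous
  set K : Set Plane := Metric.closedBall 0 (R₁ + R₂)
  have hgK : Integrable (K.indicator g) :=
    (integrable_indicator_iff Metric.isClosed_closedBall.measurableSet).2
      (hg.integrableOn_isCompact (isCompact_closedBall _ _))
  have hint : Integrable (fun p : Plane × Plane => ρ (p.1 - p.2) * g p.2 * k p.1)
      (volume.prod volume) := by
    have h1 := (hk.integrable_of_hasCompactSupport hkc (μ := volume)).mul_prod hgK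
    refine (h1.norm.const_mul C).mono' ?_ (Eventually.of_forall fun p => ?_)
    · exact (((hρ.contDiff.continuous.comp
        (continuous_fst.sub continuous_snd)).aestronglyMeasurable).mul
          hg.aestronglyMeasurable.comp_snd).mul (hk.comp continuous_fst).aestronglyMeasurable
    · have hC0 : 0 ≤ C := (norm_nonneg _).trans (hC 0)
      by_cases h0 : ρ (p.1 - p.2) * g p.2 * k p.1 = 0
      · rw [h0, norm_zero]
        positivity
      · have hρ0 : ρ (p.1 - p.2) ≠ 0 := fun h => h0 (by simp [h])
        have hk0 : k p.1 ≠ 0 := fun h => h0 (by simp [h])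
        have b1 := hR₁ (subset_tsupport ρ hρ0)
        have b2 := hR₂ (subset_tsupport k hk0)
        rw [mem_closedBall_zero_iff] at b1 b2
        have hpK : p.2 ∈ K := by
          rw [mem_closedBall_zero_iff]
          calc ‖p.2‖ = ‖p.1 - (p.1 - p.2)‖ := by rw [sub_sub_cancel]
            _ ≤ ‖p.1‖ + ‖p.1 - p.2‖ := norm_sub_le _ _
            _ ≤ R₁ + R₂ := by linarith
        rw [Set.indicator_of_mem hpK, norm_mul, norm_mul, norm_mul]
        have := mul_le_mul_of_nonneg_right (hC (p.1 - p.2))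
          (mul_nonneg (norm_nonneg (k p.1)) (norm_nonneg (g p.2)))
        linarith
  have e1 : ∀ x, mollify ρ g x * k x = ∫ y, ρ (x - y) * g y * k x := fun x => by
    rw [mollify_eq, integral_mul_const]
  have e2 : ∀ y, g y * mollify ρ k y = ∫ x, ρ (x - y) * g y * k x := fun y => by
    rw [mollify_eq, ← integral_const_mul]
    refine integral_congr_ae (Eventually.of_forall fun x => ?_)
    simp only
    rw [← hρ.even (y - x), neg_sub]
    ring
  simp only [e1, e2]
  exact integral_integral_swap hint

theorem fderiv_mollify_apply (hρ : IsMollifier ρ) {φ : Plane → ℝ} (hφ : ContDiff ℝ 1 φ)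
    (hc : HasCompactSupport φ) (x v : Plane) :
    fderiv ℝ (mollify ρ φ) x v = mollify ρ (fun y => fderiv ℝ φ y v) x := by
  have hl : LocallyIntegrable ρ := hρ.integrable.locallyIntegrable
  rw [mollify, (hc.hasFDerivAt_convolution_right (lsmul ℝ ℝ) hl hφ x).fderiv]
  exact convolution_precompR_apply _ hl (hc.fderiv ℝ) (hφ.continuous_fderiv (by simp)) x v

theorem abs_mollify_le (hρ : IsMollifier ρ) {φ : Plane → ℝ} (hφ : LocallyIntegrable φ) {C : ℝ}
    (hφC : ∀ x, |φ x| ≤ C) (x : Plane) : |mollify ρ φ x| ≤ C := by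
  have hi : Integrable (fun y => ρ (x - y)) := hρ.integrable.comp_sub_left x
  rw [mollify_eq]
  refine (abs_integral_le_integral_abs).trans ?_
  calc ∫ y, |ρ (x - y) * φ y| ≤ ∫ y, ρ (x - y) * C := by
        refine integral_mono (hρ.integrable_mul hφ x).abs (hi.mul_const C) fun y => ?_
        simp only [abs_mul, abs_of_nonneg (hρ.nonneg _)]
        exact mul_le_mul_of_nonneg_left (hφC y) (hρ.nonneg _)
    _ = C := by
        rw [integral_mul_const, integral_sub_left_eq_self ρ volume x, hρ.integral_eq_one, one_mul]

theorem divergence_smul_single {ψ : Plane → ℝ} (hψ : Differentiable ℝ ψ) (i : Fin 2) (x : Plane) :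
    divergence (fun y => ψ y • EuclideanSpace.single i (1 : ℝ)) x =
      fderiv ℝ ψ x (EuclideanSpace.single i 1) := by
  have h : HasFDerivAt (fun y => ψ y • (EuclideanSpace.single i (1 : ℝ) : Plane))
      ((fderiv ℝ ψ x).smulRight (EuclideanSpace.single i (1 : ℝ) : Plane)) x :=
    (hψ x).hasFDerivAt.smul_const _
  rw [divergence, h.fderiv, Finset.sum_eq_single i]
  · simp
  · intro j _ hj
    simp [hj]
  · simp

/-- Integration by parts moves the derivative, and self-adjointness the mollifier, onto `φ`. What
remains is `g` tested against the divergence of `-(ρ * φ) e_i`, an admissible field because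
averaging keeps the bound 1. -/
theorem integral_fderiv_mollify_mul_le (hρ : IsMollifier ρ) (hg : MemBV Set.univ g)
    {φ : Plane → ℝ} (hφ : IsTest Set.univ φ) (hφ1 : ∀ x, |φ x| ≤ 1) (i : Fin 2) :
    ENNReal.ofReal (∫ x, fderiv ℝ (mollify ρ g) x (EuclideanSpace.single i 1) * φ x) ≤
      totalVariation Set.univ g := by
  have hgl : LocallyIntegrable g := locallyIntegrableOn_univ.1 hg.1
  have hφ1' : ContDiff ℝ 1 φ := hφ.1.of_le (by exact_mod_cast le_top)
  have hφl : LocallyIntegrable φ := hφ.continuous.locallyIntegrable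
  set e : Plane := EuclideanSpace.single i 1 with he
  have hsm := contDiff_mollify hρ hgl
  set ψ : Plane → ℝ := fun x => - mollify ρ φ x with hψ
  have hmφ := contDiff_mollify hρ hφl
  have hψs : ContDiff ℝ (⊤ : ℕ∞) ψ := hmφ.neg
  have hψd : Differentiable ℝ ψ := hψs.differentiable (by simp)
  have hψc : HasCompactSupport ψ :=
    (HasCompactSupport.convolution _ hρ.hasCompactSupport hφ.2.1).neg
  have hψf : ∀ x, fderiv ℝ ψ x e = - mollify ρ (fun y => fderiv ℝ φ y e) x := fun x => by
    rw [hψ, fderiv_fun_neg, neg_apply, fderiv_mollify_apply hρ hφ1' hφ.2.1]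
  have hw : IsTest Set.univ (fun y => ψ y • e) ∧ ∀ x, ‖ψ x • e‖ ≤ 1 := by
    refine ⟨⟨hψs.smul contDiff_const, hψc.smul_right, Set.subset_univ _⟩, fun x => ?_⟩
    rw [norm_smul, he, PiLp.norm_single, norm_one, mul_one, Real.norm_eq_abs, hψ,
      abs_neg]
    exact abs_mollify_le hρ hφl hφ1 x
  have hcont : Continuous fun x => fderiv ℝ φ x e := by
    have := hφ.continuous_fderiv
    fun_prop
  have hdc : Continuous fun x => fderiv ℝ (mollify ρ g) x e := by
    have := hsm.continuous_fderiv (by simp)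
    fun_prop
  have hparts : ∫ x, fderiv ℝ (mollify ρ g) x e * φ x = - ∫ x, mollify ρ g x * fderiv ℝ φ x e := by
    have := integral_mul_fderiv_eq_neg_fderiv_mul_of_integrable (μ := (volume : Measure Plane))
      (f := mollify ρ g) (g := φ) (v := e)
      (Continuous.integrable_of_hasCompactSupport (hdc.mul hφ.continuous) hφ.2.1.mul_left)
      (Continuous.integrable_of_hasCompactSupport (hsm.continuous.mul hcont)
        (hφ.2.1.fderiv_apply ℝ e).mul_left)
      (Continuous.integrable_of_hasCompactSupport (hsm.continuous.mul hφ.continuous)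
        hφ.2.1.mul_left)
      (fun x _ => hsm.differentiable (by simp) x) (fun x _ => hφ.differentiable x)
    rw [this, neg_neg]
  rw [hparts, integral_mollify_mul hρ hgl hcont (hφ.2.1.fderiv_apply ℝ e), ← integral_neg]
  refine le_trans (le_of_eq ?_) (le_iSup₂ (f := fun (w : Plane → Plane)
    (_ : IsTest Set.univ w ∧ ∀ x, ‖w x‖ ≤ 1) =>
      ENNReal.ofReal (∫ x in Set.univ, g x * divergence w x)) (fun y => ψ y • e) hw)
  rw [setIntegral_univ]
  congr 2
  ext y
  rw [he, divergence_smul_single hψd, ← he, hψf]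
  ring

/-- Duality: the `L¹` norm of `h` is recovered by testing against smooth compactly supported
approximations of its sign. -/
theorem lintegral_fderiv_mollify_apply_le (hρ : IsMollifier ρ) (hg : MemBV Set.univ g)
    (i : Fin 2) : ∫⁻ x, ‖fderiv ℝ (mollify ρ g) x (EuclideanSpace.single i 1)‖ₑ ≤
      totalVariation Set.univ g := by
  obtain ⟨χ, C, hχ, hχc, hχb, hχd, hχl⟩ := exists_cutoff
  have hgl : LocallyIntegrable g := locallyIntegrableOn_univ.1 hg.1
  set h : Plane → ℝ := fun x => fderiv ℝ (mollify ρ g) x (EuclideanSpace.single i 1) with hh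
  have hhs : ContDiff ℝ (⊤ : ℕ∞) h :=
    ((contDiff_mollify hρ hgl).fderiv_right (by simp)).clm_apply contDiff_const
  set δ : ℕ → ℝ := fun n => 1 / ((n : ℝ) + 1)
  have hδ : ∀ n, 0 < δ n := fun n => Nat.one_div_pos_of_nat
  have hpos : ∀ n x, 0 < h x ^ 2 + δ n := fun n x => add_pos_of_nonneg_of_pos (sq_nonneg _) (hδ n)
  -- The regularization `δ n > 0` keeps this sign smooth at zeros of `h`, and `h * φ n` stays
  -- nonnegative.
  set φ : ℕ → Plane → ℝ := fun n x => χ n x * (h x / √(h x ^ 2 + δ n)) with hφdef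
  have hφt : ∀ n, IsTest Set.univ (φ n) := fun n =>
    ⟨(hχ n).mul (hhs.div (((hhs.pow 2).add contDiff_const).sqrt fun x => (hpos n x).ne')
      fun x => (Real.sqrt_pos.2 (hpos n x)).ne'), (hχc n).mul_right, Set.subset_univ _⟩
  have hφ1 : ∀ n x, |φ n x| ≤ 1 := by
    intro n x
    rw [hφdef, abs_mul, abs_of_nonneg (hχb n x).1, abs_div, abs_of_nonneg (Real.sqrt_nonneg _)]
    refine mul_le_one₀ (hχb n x).2 (by positivity)
      ((div_le_one (Real.sqrt_pos.2 (hpos n x))).2 (Real.le_sqrt_of_sq_le ?_))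
    rw [sq_abs]
    linarith [hδ n]
  have hnn : ∀ n x, 0 ≤ h x * φ n x := by
    intro n x
    have : h x * φ n x = χ n x * (h x ^ 2 / √(h x ^ 2 + δ n)) := by
      simp only [hφdef]
      ring
    rw [this]
    exact mul_nonneg (hχb n x).1 (by positivity)
  have hcont : ∀ n, Continuous fun x => h x * φ n x := fun n =>
    hhs.continuous.mul (hφt n).continuous
  have hlim : ∀ x, Tendsto (fun n => h x * φ n x) atTop (𝓝 |h x|) := by
    intro x
    rcases eq_or_ne (h x) 0 with h0 | h0
    · simp [h0]
    · have h1 : Tendsto (fun n => √(h x ^ 2 + δ n)) atTop (𝓝 √(h x ^ 2 + 0)) :=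
        (Real.continuous_sqrt.tendsto _).comp
          ((tendsto_one_div_add_atTop_nhds_zero_nat (𝕜 := ℝ)).const_add _)
      rw [add_zero, Real.sqrt_sq_eq_abs] at h1
      have h2 := ((hχl x).mul ((tendsto_const_nhds (x := h x)).div h1 (abs_ne_zero.2 h0))).const_mul (h x)
      have h3 : h x * (1 * (h x / |h x|)) = |h x| := by
        rw [one_mul, ← mul_div_assoc, ← sq, ← sq_abs, sq, mul_self_div_self]
      rwa [h3] at h2
  have := lintegral_enorm_le_of_tendsto (F := fun n x => h x * φ n x) (h := fun x => |h x|)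
    (M := totalVariation Set.univ g) (fun n => (hcont n).aestronglyMeasurable) hlim fun n => by
      have hint : Integrable fun x => h x * φ n x :=
        (hcont n).integrable_of_hasCompactSupport (hφt n).2.1.mul_left
      refine le_trans (le_of_eq ?_) (integral_fderiv_mollify_mul_le hρ hg (hφt n) (hφ1 n) i)
      rw [ofReal_integral_eq_lintegral_ofReal hint (Eventually.of_forall (hnn n))]
      exact lintegral_congr fun x => Real.enorm_eq_ofReal (hnn n x)
  simpa only [Real.enorm_abs] using this

theorem enorm_clm_le_sum (L : Plane →L[ℝ] ℝ) :
    ‖L‖ₑ ≤ ∑ i : Fin 2, ‖L (EuclideanSpace.single i 1)‖ₑ := by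
  have h : ‖L‖ ≤ ∑ i : Fin 2, ‖L (EuclideanSpace.single i 1)‖ := by
    refine L.opNorm_le_bound (Finset.sum_nonneg fun _ _ => norm_nonneg _) fun x => ?_
    conv_lhs => rw [← (EuclideanSpace.basisFun (Fin 2) ℝ).sum_repr x]
    rw [map_sum, Finset.sum_mul]
    refine (norm_sum_le _ _).trans (Finset.sum_le_sum fun i _ => ?_)
    rw [map_smul, norm_smul, mul_comm]
    simp only [EuclideanSpace.basisFun_repr, EuclideanSpace.basisFun_apply]
    exact mul_le_mul_of_nonneg_left (PiLp.norm_apply_le x i) (norm_nonneg _)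
  simp only [← ofReal_norm]
  rw [← ENNReal.ofReal_sum_of_nonneg fun _ _ => norm_nonneg _]
  exact ENNReal.ofReal_le_ofReal h

/-- The factor 2 counts the coordinates; sharpness is irrelevant, since only some finite embedding
constant is sought. -/
theorem lintegral_fderiv_mollify_le (hρ : IsMollifier ρ) (hg : MemBV Set.univ g) :
    ∫⁻ x, ‖fderiv ℝ (mollify ρ g) x‖ₑ ≤ 2 * totalVariation Set.univ g := by
  have hsm := contDiff_mollify hρ (locallyIntegrableOn_univ.1 hg.1)
  have hc := hsm.continuous_fderiv (by simp)
  calc ∫⁻ x, ‖fderiv ℝ (mollify ρ g) x‖ₑ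
      ≤ ∫⁻ x, ∑ i : Fin 2, ‖fderiv ℝ (mollify ρ g) x (EuclideanSpace.single i 1)‖ₑ :=
        lintegral_mono fun x => enorm_clm_le_sum _
    _ = ∑ i : Fin 2, ∫⁻ x, ‖fderiv ℝ (mollify ρ g) x (EuclideanSpace.single i 1)‖ₑ :=
        lintegral_finsetSum _ fun i _ => by
          have : Continuous fun x => fderiv ℝ (mollify ρ g) x (EuclideanSpace.single i 1) := by
            fun_prop
          exact this.enorm.measurable
    _ ≤ ∑ _i : Fin 2, totalVariation Set.univ g :=
        Finset.sum_le_sum fun i _ => lintegral_fderiv_mollify_apply_le hρ hg i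
    _ = _ := by simp

theorem measure_lt_abs_lt_top {h : Plane → ℝ} (hh : Integrable h) {t : ℝ} (ht : 0 < t) :
    volume {x | t < |h x|} < ∞ :=
  (measure_mono fun x (hx : t < |h x|) => hx.le).trans_lt (hh.measure_norm_ge_lt_top ht)

/-- This is where membership in `L¹` or `L²` is used; nonzero constants, of zero variation, must be
excluded. In the `L²` case `|g| ≤ t / 2 + (2 / t) g²` is averaged against `ρ`, so `|ρ * g| > t`
forces the integrable function `ρ * g²` above `t² / 4`. -/
theorem measure_lt_mollify_lt_top (hρ : IsMollifier ρ) (hg : MemLp g 1 ∨ MemLp g 2) {t : ℝ}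
    (ht : 0 < t) : volume {x | t < |mollify ρ g x|} < ∞ := by
  rcases hg with hg | hg
  · exact measure_lt_abs_lt_top
      (hρ.integrable.integrable_convolution (lsmul ℝ ℝ) (memLp_one_iff_integrable.1 hg)) ht
  · have hgl : LocallyIntegrable g := hg.locallyIntegrable (by norm_num)
    have hsq : Integrable (fun x => g x ^ 2) := hg.integrable_sq
    have hm : Integrable (mollify ρ fun x => g x ^ 2) :=
      hρ.integrable.integrable_convolution (lsmul ℝ ℝ) hsq
    refine lt_of_le_of_lt (measure_mono ?_)
      (measure_lt_abs_lt_top hm (t := t ^ 2 / 4) (by positivity))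
    intro x (hx : t < |mollify ρ g x|)
    have hi : Integrable (fun y => ρ (x - y)) := hρ.integrable.comp_sub_left x
    have h2 := hρ.integrable_mul hsq.locallyIntegrable x
    have hle : |mollify ρ g x| ≤ t / 2 + (2 / t) * mollify ρ (fun x => g x ^ 2) x := by
      rw [mollify_eq, mollify_eq]
      refine abs_integral_le_integral_abs.trans ?_
      calc ∫ y, |ρ (x - y) * g y|
          ≤ ∫ y, (ρ (x - y) * (t / 2) + (2 / t) * (ρ (x - y) * g y ^ 2)) := by
            refine integral_mono (hρ.integrable_mul hgl x).abs
              ((hi.mul_const _).add (h2.const_mul _)) fun y => ?_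
            simp only [abs_mul, abs_of_nonneg (hρ.nonneg _)]
            have : |g y| ≤ t / 2 + (2 / t) * g y ^ 2 := by
              have h3 : 0 ≤ (|g y| - t / 2) ^ 2 + |g y| * (t / 2) := by positivity
              have h4 : t / 2 * |g y| ≤ t / 2 * (t / 2 + (2 / t) * g y ^ 2) := by
                rw [mul_add, ← mul_assoc, show t / 2 * (2 / t) = 1 by field_simp, one_mul,
                  ← sq_abs (g y)]
                nlinarith
              exact le_of_mul_le_mul_left h4 (by positivity)
            nlinarith [mul_le_mul_of_nonneg_left this (hρ.nonneg (x - y))]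
        _ = _ := by
            rw [integral_add (hi.mul_const _) (h2.const_mul _), integral_mul_const,
              integral_const_mul, integral_sub_left_eq_self ρ volume x, hρ.integral_eq_one,
              one_mul]
    have h5 : t / 2 < (2 / t) * mollify ρ (fun x => g x ^ 2) x := by linarith
    have h6 : t ^ 2 / 4 < mollify ρ (fun x => g x ^ 2) x := by
      have := mul_lt_mul_of_pos_left h5 (show 0 < t / 2 by positivity)
      rw [← mul_assoc, show t / 2 * (2 / t) = 1 by field_simp, one_mul] at this
      linarith
    exact h6.trans_le (le_abs_self _)

/-- The strict inequality is an open condition, so the indicator is at most the limit inferior of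
the indicators; then Fatou's lemma applies. -/
theorem measure_lt_le_liminf {F : ℕ → Plane → ℝ} {h : Plane → ℝ} (hF : ∀ n, Measurable (F n))
    (hh : AEMeasurable h) (hlim : ∀ᵐ x, Tendsto (fun n => F n x) atTop (𝓝 (h x))) (s : ℝ) :
    volume {x | s < |h x|} ≤ liminf (fun n => volume {x | s < |F n x|}) atTop := by
  have hm : ∀ n, MeasurableSet {x | s < |F n x|} := fun n =>
    measurableSet_lt measurable_const (hF n).norm
  have hm' : NullMeasurableSet {x | s < |h x|} := nullMeasurableSet_lt aemeasurable_const hh.norm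
  calc volume {x | s < |h x|} = ∫⁻ x, {x | s < |h x|}.indicator 1 x :=
        (lintegral_indicator_one₀ hm').symm
    _ ≤ ∫⁻ x, liminf (fun n => {x | s < |F n x|}.indicator 1 x) atTop := by
        refine lintegral_mono_ae (hlim.mono fun x hx => ?_)
        by_cases hs : s < |h x|
        · refine le_liminf_of_le (by isBoundedDefault) ?_
          filter_upwards [hx.abs.eventually (lt_mem_nhds hs)] with n hn
          rw [Set.indicator_of_mem (by exact hs), Set.indicator_of_mem (by exact hn)]
        · rw [Set.indicator_of_notMem (by exact hs)]
          exact zero_le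
    _ ≤ liminf (fun n => ∫⁻ x, {x | s < |F n x|}.indicator 1 x) atTop :=
        lintegral_liminf_le fun n => measurable_one.indicator (hm n)
    _ = _ := by simp only [lintegral_indicator_one (hm _)]

theorem lorentzNorm_le_of_tendsto {F : ℕ → Plane → ℝ} {h : Plane → ℝ} {M : ℝ≥0∞}
    (hF : ∀ n, Measurable (F n)) (hh : AEMeasurable h)
    (hlim : ∀ᵐ x, Tendsto (fun n => F n x) atTop (𝓝 (h x))) (hM : ∀ n, lorentzNorm (F n) ≤ M) :
    lorentzNorm h ≤ M := by
  have hmeas : ∀ n, Measurable fun s : ℝ => volume {x | s < |F n x|} ^ (1 / 2 : ℝ) := fun n =>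
    Antitone.measurable fun a b hab => by
      gcongr
  calc lorentzNorm h
      ≤ 2 * ∫⁻ s in Set.Ioi (0 : ℝ), liminf (fun n => volume {x | s < |F n x|} ^ (1 / 2 : ℝ)) atTop := by
        unfold lorentzNorm
        gcongr with s
        -- The square root commutes with the limit inferior, being an order isomorphism.
        have e := (ENNReal.orderIsoRpow (1 / 2) (by norm_num)).liminf_apply
          (f := atTop) (u := fun n => volume {x | s < |F n x|})
        simp only [ENNReal.orderIsoRpow_apply] at e
        rw [← e]
        exact ENNReal.rpow_le_rpow (measure_lt_le_liminf hF hh hlim s) (by norm_num)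
    _ ≤ 2 * liminf (fun n => ∫⁻ s in Set.Ioi (0 : ℝ), volume {x | s < |F n x|} ^ (1 / 2 : ℝ)) atTop := by
        gcongr
        exact lintegral_liminf_le hmeas
    _ ≤ 2 * (M / 2) := by
        gcongr
        refine liminf_le_of_frequently_le' (Frequently.of_forall fun n => ?_)
        rw [ENNReal.le_div_iff_mul_le (by simp) (by simp), mul_comm]
        exact hM n
    _ = M := ENNReal.mul_div_cancel (by simp) (by simp)

theorem exists_isEmbeddingConst : ∃ β : ℝ≥0, IsEmbeddingConst β := by
  obtain ⟨K, hK⟩ := exists_lorentzNorm_le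
  refine ⟨K * 2, fun g hg hp => ?_⟩
  have hgl : LocallyIntegrable g := locallyIntegrableOn_univ.1 hg.1
  let b : ℕ → ContDiffBump (0 : Plane) := fun n =>
    ⟨1 / ((n : ℝ) + 1), 2 * (1 / ((n : ℝ) + 1)), Nat.one_div_pos_of_nat, by
      have : 0 < 1 / ((n : ℝ) + 1) := Nat.one_div_pos_of_nat
      linarith⟩
  have hb : ∀ n, IsMollifier ((b n).normed volume) := fun n => (b n).isMollifier
  have hsm := fun n => contDiff_mollify (hb n) hgl
  refine lorentzNorm_le_of_tendsto (F := fun n => mollify ((b n).normed volume) g)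
    (fun n => (hsm n).continuous.measurable) hgl.aestronglyMeasurable.aemeasurable ?_ fun n => ?_
  · refine ContDiffBump.ae_convolution_tendsto_right_of_locallyIntegrable (φ := b) (K := 2) ?_
      (Eventually.of_forall fun n => le_rfl) hgl
    simpa only [mul_zero] using
      (tendsto_one_div_add_atTop_nhds_zero_nat (𝕜 := ℝ)).const_mul 2
  · refine (hK _ ((hsm n).of_le (by exact_mod_cast le_top))
      fun t ht => measure_lt_mollify_lt_top (hb n) hp ht).trans ?_
    rw [ENNReal.coe_mul, mul_assoc]
    gcongr
    exact lintegral_fderiv_mollify_le (hb n) hg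

end Mollification

/-! ### The two-step bounded solution -/

section TwoStepConstruction

variable {f : Plane → ℝ} {u : Plane → Plane} {β : ℝ≥0}

/-- The zero field costs `lam ‖f‖₂²`, which for `lam = 1 / ‖f‖₂` is `‖f‖₂`. -/
theorem IsMinimizer.eLpNorm_le (hf : MemLp f 2) (hf0 : eLpNorm f 2 volume ≠ 0)
    (hu : IsMinimizer Set.univ f (eLpNorm f 2 volume).toReal⁻¹ u) :
    eLpNorm u ∞ volume ≤ eLpNorm f 2 volume := by
  have hfin := hf.eLpNorm_lt_top.ne
  have hpos : 0 < (eLpNorm f 2 volume).toReal := ENNReal.toReal_pos hf0 hfin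
  have h := hu.le_zero
  rw [functional_zero isOpen_univ (by rwa [Measure.restrict_univ]), functional,
    Measure.restrict_univ, ENNReal.ofReal_inv_of_pos hpos, ENNReal.ofReal_toReal hfin, sq,
    ← mul_assoc, ENNReal.inv_mul_cancel hf0 hfin, one_mul] at h
  exact le_self_add.trans h

theorem IsMinimizer.totalVariation_le_half (hf : MemLp f 2) (hf0 : eLpNorm f 2 volume ≠ 0)
    (hu : IsMinimizer Set.univ f (eLpNorm f 2 volume).toReal⁻¹ u) {r : Plane → ℝ}
    (hr : IsResidual Set.univ f u r) :
    totalVariation Set.univ r ≤ eLpNorm f 2 volume / 2 := by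
  have hfin := hf.eLpNorm_lt_top.ne
  have hpos : 0 < (eLpNorm f 2 volume).toReal := ENNReal.toReal_pos hf0 hfin
  refine (hu.totalVariation_le isOpen_univ (inv_pos.2 hpos) hr).trans (le_of_eq ?_)
  rw [show 1 / (2 * (eLpNorm f 2 volume).toReal⁻¹) = (eLpNorm f 2 volume).toReal / 2 by
    field_simp, ENNReal.ofReal_div_of_pos two_pos, ENNReal.ofReal_toReal hfin, ENNReal.ofReal_ofNat]

theorem IsMinimizer.lorentzNorm_residual_le (hβ : IsEmbeddingConst β) (hf : MemLp f 2)
    (hf0 : eLpNorm f 2 volume ≠ 0)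
    (hu : IsMinimizer Set.univ f (eLpNorm f 2 volume).toReal⁻¹ u) {r : Plane → ℝ}
    (hr : IsResidual Set.univ f u r) :
    lorentzNorm r ≤ (β : ℝ≥0∞) / 2 * eLpNorm f 2 volume := by
  have hpos : 0 < (eLpNorm f 2 volume).toReal := ENNReal.toReal_pos hf0 hf.eLpNorm_lt_top.ne
  have hr2 : MemLp r 2 := by simpa only [Measure.restrict_univ] using hr.1
  refine (hβ r (hu.memBV isOpen_univ (inv_pos.2 hpos) hr) (Or.inr hr2)).trans ?_
  refine (mul_le_mul_right (hu.totalVariation_le_half hf hf0 hr) _).trans (le_of_eq ?_)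
  simp only [div_eq_mul_inv]
  ring

theorem two_step_solution (hβ : IsEmbeddingConst β) (hf : MemLp f 2)
    (hf0 : eLpNorm f 2 volume ≠ 0)
    (hu : IsMinimizer Set.univ f (eLpNorm f 2 volume).toReal⁻¹ u) {r : Plane → ℝ}
    (hr : IsResidual Set.univ f u r) :
    (∀ x, Integrable (fun y => r y • kernel (x - y)) volume) ∧
      IsWeakDiv Set.univ (helmholtz r) r ∧
      eLpNorm (helmholtz r) ∞ volume ≤ weakNorm kernel * lorentzNorm r ∧
      eLpNorm (helmholtz r) ∞ volume ≤
        (β : ℝ≥0∞) / 2 * weakNorm kernel * eLpNorm f 2 volume ∧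
      MemLp (fun x => u x + helmholtz r x) ∞ volume ∧
      IsWeakDiv Set.univ (fun x => u x + helmholtz r x) f ∧
      eLpNorm (fun x => u x + helmholtz r x) ∞ volume ≤
        (1 + (β : ℝ≥0∞) / 2 * weakNorm kernel) * eLpNorm f 2 volume := by
  have hr2 : MemLp r 2 := by simpa only [Measure.restrict_univ] using hr.1
  have hu1 : MemLp u ∞ := by simpa only [Measure.restrict_univ] using hu.1
  have hL := hu.lorentzNorm_residual_le hβ hf hf0 hr
  have hLfin : lorentzNorm r < ∞ := hL.trans_lt (ENNReal.mul_lt_top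
    (ENNReal.div_lt_top ENNReal.coe_ne_top (by norm_num)) hf.eLpNorm_lt_top)
  have hn := eLpNorm_helmholtz_le hr2.1
  have hn' : eLpNorm (helmholtz r) ∞ volume ≤
      (β : ℝ≥0∞) / 2 * weakNorm kernel * eLpNorm f 2 volume := by
    refine hn.trans ((mul_le_mul_right hL _).trans (le_of_eq ?_))
    ring
  have hmem : MemLp (helmholtz r) ∞ := ⟨aestronglyMeasurable_helmholtz hr2.1,
    hn.trans_lt (ENNReal.mul_lt_top weakNorm_kernel_lt_top hLfin)⟩
  have hdiv := isWeakDiv_helmholtz (hr2.locallyIntegrable (by norm_num)) hLfin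
  refine ⟨fun x => integrable_smul_kernel hr2.1 hLfin x, hdiv, hn, hn', hu1.add hmem,
    (hr.2.add hdiv).congr_right fun x => by ring, ?_⟩
  refine (eLpNorm_add_le hu1.1 hmem.1 le_top).trans ?_
  rw [add_mul, one_mul]
  exact add_le_add (hu.eLpNorm_le hf hf0) hn'

theorem exists_bounded_solution (hβ : IsEmbeddingConst β) (hf : MemLp f 2) :
    ∃ u : Plane → Plane, MemLp u ∞ ∧ IsWeakDiv Set.univ u f ∧
      eLpNorm u ∞ volume ≤ (1 + (β : ℝ≥0∞) / 2 * weakNorm kernel) * eLpNorm f 2 volume := by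
  rcases eq_or_ne (eLpNorm f 2 volume) 0 with h0 | h0
  -- For `‖f‖₂ = 0` the parameter `1 / ‖f‖₂` is not available; the zero field is a solution.
  · refine ⟨0, MemLp.zero, ?_, by simp⟩
    have hf0 : f =ᵐ[volume] 0 := (eLpNorm_eq_zero_iff hf.1 (by norm_num)).1 h0
    exact isWeakDiv_zero.congr_ae (ae_eq_refl _)
      (by rw [Measure.restrict_univ]; exact hf0.symm)
  · have hf' : MemLp f 2 (volume.restrict Set.univ) := by rwa [Measure.restrict_univ]
    have hpos : 0 < (eLpNorm f 2 volume).toReal⁻¹ :=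
      inv_pos.2 (ENNReal.toReal_pos h0 hf.eLpNorm_lt_top.ne)
    obtain ⟨u, hu⟩ := exists_isMinimizer isOpen_univ hf' hpos
    obtain ⟨r, hr⟩ := hu.exists_isResidual isOpen_univ hf' hpos
    have h := (two_step_solution hβ hf h0 hu hr).2.2.2.2
    exact ⟨_, h.1, h.2.1, h.2.2⟩

/-- Extension of `f` by zero keeps its norm, and every test function on `Ω` is one on the plane, so
the solution on the plane restricts to `Ω`. -/
theorem exists_bounded_solution_on (hβ : IsEmbeddingConst β) {Ω : Set Plane} (hΩ : IsOpen Ω)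
    (hf : MemLp f 2 (volume.restrict Ω)) :
    ∃ u : Plane → Plane, MemLp u ∞ (volume.restrict Ω) ∧ IsWeakDiv Ω u f ∧
      eLpNorm u ∞ (volume.restrict Ω) ≤
        (1 + (β : ℝ≥0∞) / 2 * weakNorm kernel) * eLpNorm f 2 (volume.restrict Ω) := by
  obtain ⟨u, hu, hdiv, hle⟩ := exists_bounded_solution hβ
    ((memLp_indicator_iff_restrict hΩ.measurableSet).2 hf)
  rw [eLpNorm_indicator_eq_eLpNorm_restrict hΩ.measurableSet] at hle
  exact ⟨u, hu.restrict _, (hdiv.mono (Set.subset_univ Ω)).congr_ae (ae_eq_refl _)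
      (indicator_ae_eq_restrict hΩ.measurableSet),
    (eLpNorm_restrict_le _ _ _ _).trans hle⟩

end TwoStepConstruction

end TwoStep

theorem mainTheorem6 :
    (∀ Ω : Set Plane, IsOpen Ω → ∀ f : Plane → ℝ, MemLp f 2 (volume.restrict Ω) →
      ∀ lam : ℝ, 0 < lam →
        (∃ u : Plane → Plane, IsMinimizer Ω f lam u) ∧
        ∀ u : Plane → Plane, IsMinimizer Ω f lam u →
          (∃ r : Plane → ℝ, IsResidual Ω f u r) ∧
          ∀ r : Plane → ℝ, IsResidual Ω f u r →
            MemBV Ω r ∧ totalVariation Ω r ≤ ENNReal.ofReal (1 / (2 * lam)) ∧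
            (volume Ω < ∞ → IntegrableOn r Ω)) ∧
    weakNorm kernel < ∞ ∧
    (∃ β : ℝ≥0, IsEmbeddingConst β) ∧
    ∀ β : ℝ≥0, IsEmbeddingConst β →
      (∀ f : Plane → ℝ, MemLp f 2 volume → eLpNorm f 2 volume ≠ 0 →
        ∀ (u₁ : Plane → Plane) (r₁ : Plane → ℝ),
          IsMinimizer Set.univ f (eLpNorm f 2 volume).toReal⁻¹ u₁ →
          IsResidual Set.univ f u₁ r₁ →
            eLpNorm u₁ ∞ volume ≤ eLpNorm f 2 volume ∧
            lorentzNorm r₁ ≤ (β : ℝ≥0∞) / 2 * eLpNorm f 2 volume ∧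
            (∀ x, Integrable (fun y => r₁ y • kernel (x - y)) volume) ∧
            IsWeakDiv Set.univ (helmholtz r₁) r₁ ∧
            eLpNorm (helmholtz r₁) ∞ volume ≤ weakNorm kernel * lorentzNorm r₁ ∧
            eLpNorm (helmholtz r₁) ∞ volume ≤
              (β : ℝ≥0∞) / 2 * weakNorm kernel * eLpNorm f 2 volume ∧
            MemLp (fun x => u₁ x + helmholtz r₁ x) ∞ volume ∧
            IsWeakDiv Set.univ (fun x => u₁ x + helmholtz r₁ x) f ∧
            eLpNorm (fun x => u₁ x + helmholtz r₁ x) ∞ volume ≤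
              (1 + (β : ℝ≥0∞) / 2 * weakNorm kernel) * eLpNorm f 2 volume) ∧
      (∀ Ω : Set Plane, IsOpen Ω → ∀ f : Plane → ℝ, MemLp f 2 (volume.restrict Ω) →
        ∃ u : Plane → Plane, MemLp u ∞ (volume.restrict Ω) ∧ IsWeakDiv Ω u f ∧
          eLpNorm u ∞ (volume.restrict Ω) ≤
            (1 + (β : ℝ≥0∞) / 2 * weakNorm kernel) * eLpNorm f 2 (volume.restrict Ω)) := by
  refine ⟨fun Ω hΩ f hf lam hlam => ⟨exists_isMinimizer hΩ hf hlam, fun u hu =>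
      ⟨hu.exists_isResidual hΩ hf hlam, fun r hr => ⟨hu.memBV hΩ hlam hr,
        hu.totalVariation_le hΩ hlam hr, fun hvol => ?_⟩⟩⟩,
    weakNorm_kernel_lt_top, exists_isEmbeddingConst, fun β hβ =>
      ⟨fun f hf hf0 u₁ r₁ hu hr => ⟨hu.eLpNorm_le hf hf0,
        hu.lorentzNorm_residual_le hβ hf hf0 hr, two_step_solution hβ hf hf0 hu hr⟩,
      fun Ω hΩ f hf => exists_bounded_solution_on hβ hΩ hf⟩⟩
  have : IsFiniteMeasure (volume.restrict Ω) := ⟨by rwa [Measure.restrict_apply_univ]⟩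
  exact hr.1.integrable (by norm_num)
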